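/- Let $d,K,m,J$ be natural numbers, $X=\mathbb R^d$, $y\in\mathbb R^K$, let $\Gamma\in\mathbb R^{K\times K}$ and $C_0\in\mathbb R^{d\times d}$ be symmetric positive definite, $\lambda>0$, $\tau>0$, and let $G:X\to\mathbb R^K$ and $h_1,\dots,h_m:X\to\mathbb R$. Put $$\Phi^{\mathrm{reg}}(u)=\tfrac12\langle G(u)-y,\Gamma^{-1}(G(u)-y)\rangle+\tfrac{\lambda}{2}\langle u,C_0^{-1}u\rangle,\qquad \Phi^b(u)=\Phi^{\mathrm{reg}}(u)-\frac1\tau\sum_{i=1}^m\log(-h_i(u)),$$ where $\Phi^b(u)$ is understood to be $+\infty$ unless $h_i(u)<0$ for all $i$. Assume: 1. $\Phi^{\mathrm{reg}}$ is $C^2$; for some $\mu>0$, $\Phi^{\mathrm{reg}}(x_1)-\Phi^{\mathrm{reg}}(x_2)\ge\langle\nabla\Phi^{\mathrm{reg}}(x_2),x_1-x_2\rangle+\frac\mu2\|x_1-x_2\|^2$ for all $x_1,x_2\in X$; and $\nabla\Phi^{\mathrm{reg}}$ is $L$-Lipschitz on $X$ for some $L>0$. 2. $G$ is locally Lipschitz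 and differentiable, and for some $b_{res}$, $\|G(x_1)-G(x_2)-DG(x_2)(x_1-x_2)\|\le b_{res}\|x_1-x_2\|^2$ for all $x_1,x_2\in X$. 3. Each $h_i$ is convex and $C^1$, and there is $u\in X$ with $h_i(u)<0$ for all $i$. For an ensemble $u=(u^{(j)})_{j=1}^J$ in $X$ write $\bar u=\frac1J\sum_j u^{(j)}$, $\bar G(u)=\frac1J\sum_jG(u^{(j)})$, $\widehat C(u)=\frac1J\sum_j(u^{(j)}-\bar u)\otimes(u^{(j)}-\bar u)$ and $\widehat C^{u,G}=\frac1J\sum_j(u^{(j)}-\bar u)\otimes(G(u^{(j)})-\bar G(u))$. Let $\rho:[0,\infty)\to[0,1]$ satisfy $\rho_t\to1$ as $t\to\infty$. Let $J>d$ and let $(u_t^{(j)})_{t\ge0}$, $j=1,\dots,J$, be a solution on $[0,\infty)$ of the covariance-inflated log-barrier EKI flow $$\frac{\mathrm d u_t^{(j)}}{\mathrm dt}=-\widehat C_t^{u,G}\Gamma^{-1}(G(u_t^{(j)})-y)-\lambda\,\widehat C(u_t)C_0^{-1}u_t^{(j)}+\rho_t\,\widehat C_t^{u,G}\Gamma^{-1}(G(u_t^{(j)})-\bar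 G(u_t))+\frac1\tau\widehat C(u_t)\sum_{i=1}^m\frac{1}{h_i(\bar u_t)}\nabla h_i(\bar u_t)$$ (in particular $h_i(\bar u_t)\ne0$ for all $i$ and $t$), such that $h_i(\bar u_0)<0$ for all $i$ and the initial empirical covariance $\widehat C(u_0)$ is positive definite. Let $u_*^\tau$ be the global minimiser of $\Phi^b$. Then $h_i(\bar u_t)<0$ for all $i$ and all $t\ge0$. Moreover, for every $$\gamma>\max\Big\{1,\frac{\lambda\,\sigma_{\max}}{\mu}\Big\},\qquad \sigma_{\max}=\|C_0^{-1}\|\ \text{(the largest eigenvalue of }C_0^{-1}),$$ a range that depends neither on $t$ nor on $\tau$, there exist $c_1,c_2>0$ and $\bar t\ge0$ such that $$\Phi^b(\bar u_t)-\Phi^b(u_*^\tau)\le\Big(\frac{c_1}{t+c_2}\Big)^{1/\gamma}\qquad\text{for all }t\ge\bar t .$$ In particular $\lim_{t\to\infty}\big(\Phi^b(\bar u_t)-\Phi^b(u_*^\tau)\big)=0$. -/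

import Mathlib

open Filter Topology

namespace EKI

noncomputable section

/-- Euclidean space `ℝⁿ`. -/
abbrev Vec (n : ℕ) : Type := EuclideanSpace ℝ (Fin n)

/-- A square matrix acting on Euclidean space. -/
def act {n : ℕ} (M : Matrix (Fin n) (Fin n) ℝ) : Vec n →L[ℝ] Vec n :=
  Matrix.toEuclideanCLM (n := Fin n) (𝕜 := ℝ) M

/-- The Tikhonov regularised potential
`Φ^reg(u) = ½ ⟨G(u) - y, Γ⁻¹ (G(u) - y)⟩ + (lam / 2) ⟨u, C₀⁻¹ u⟩`. -/
def regPotential {d K : ℕ} (G : Vec d → Vec K) (y : Vec K)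
    (Γ : Matrix (Fin K) (Fin K) ℝ) (C₀ : Matrix (Fin d) (Fin d) ℝ) (lam : ℝ) (u : Vec d) : ℝ :=
  1 / 2 * inner ℝ (G u - y) (act Γ⁻¹ (G u - y)) + lam / 2 * inner ℝ u (act C₀⁻¹ u)

/-- Strict feasibility: `h_i(u) < 0` for every constraint. -/
def StrictlyFeasible {d m : ℕ} (h : Fin m → Vec d → ℝ) (u : Vec d) : Prop :=
  ∀ i, h i u < 0

/-- The log-barrier potential `Φ^b(u) = Φ(u) - (1/τ) ∑ i, log (-h_i(u))` attached to an
objective `Φ`.  It is meant only at strictly feasible points (elsewhere it is `+∞` by convention,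
and the value below is not used). -/
def barrierPotential {d m : ℕ} (Φ : Vec d → ℝ) (h : Fin m → Vec d → ℝ) (τ : ℝ) (u : Vec d) : ℝ :=
  Φ u - 1 / τ * ∑ i, Real.log (-(h i u))

/-- `v` is a global minimiser of the log-barrier potential (which is `+∞` at the points that are
not strictly feasible). -/
def IsBarrierMinimiser {d m : ℕ} (Φ : Vec d → ℝ) (h : Fin m → Vec d → ℝ) (τ : ℝ)
    (v : Vec d) : Prop :=
  StrictlyFeasible h v ∧
    ∀ w, StrictlyFeasible h w → barrierPotential Φ h τ v ≤ barrierPotential Φ h τ w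

/-- The mean of a finite family of vectors. -/
def mean {J n : ℕ} (x : Fin J → Vec n) : Vec n :=
  (1 / (J : ℝ)) • ∑ j, x j

/-- The empirical cross-covariance `(1/J) ∑ j, (x_j - x̄) ⊗ (z_j - z̄)`, as an operator;
`(a ⊗ b) w = ⟨b, w⟩ a`. -/
def crossCov {J n k : ℕ} (x : Fin J → Vec n) (z : Fin J → Vec k) : Vec k →L[ℝ] Vec n :=
  (1 / (J : ℝ)) • ∑ j, InnerProductSpace.rankOne ℝ (x j - mean x) (z j - mean z)

/-- The empirical covariance `Ĉ(x)`. -/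
def cov {J n : ℕ} (x : Fin J → Vec n) : Vec n →L[ℝ] Vec n :=
  crossCov x x

/-- The drift of particle `j` of the Tikhonov regularised EKI with inflation factors `ρ`
(on the data misfit) and `β` (on the regularisation). -/
def inflatedDrift {d K J : ℕ} (G : Vec d → Vec K) (y : Vec K)
    (Γ : Matrix (Fin K) (Fin K) ℝ) (C₀ : Matrix (Fin d) (Fin d) ℝ) (lam ρ β : ℝ)
    (u : Fin J → Vec d) (j : Fin J) : Vec d :=
  -(crossCov u (fun k => G (u k)) (act Γ⁻¹ (G (u j) - y)))
    - lam • cov u (act C₀⁻¹ (u j))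
    + ρ • crossCov u (fun k => G (u k)) (act Γ⁻¹ (G (u j) - mean (fun k => G (u k))))
    + (β * lam) • cov u (act C₀⁻¹ (u j - mean u))

/-- The log-barrier force `(1/τ) Ĉ(u) ∑ i, (1 / h_i(ū)) ∇h_i(ū)`, common to all particles. -/
def barrierForce {d m J : ℕ} (h : Fin m → Vec d → ℝ) (τ : ℝ) (u : Fin J → Vec d) : Vec d :=
  (1 / τ) • cov u (∑ i, (1 / h i (mean u)) • gradient (h i) (mean u))

/-- `u` is a solution on `[0, ∞)` of the covariance-inflated log-barrier EKI flow: the right-hand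
side is defined along `u` (no `h_i(ū_t)` vanishes) and every particle satisfies its equation. -/
structure IsFlowSolution {d K m J : ℕ} (G : Vec d → Vec K) (y : Vec K)
    (Γ : Matrix (Fin K) (Fin K) ℝ) (C₀ : Matrix (Fin d) (Fin d) ℝ) (lam : ℝ)
    (h : Fin m → Vec d → ℝ) (τ : ℝ) (ρ β : ℝ → ℝ) (u : ℝ → Fin J → Vec d) : Prop where
  ne_zero : ∀ t, 0 ≤ t → ∀ i, h i (mean (u t)) ≠ 0
  hasDeriv : ∀ t, 0 ≤ t → ∀ j,
    HasDerivWithinAt (fun s => u s j)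
      (inflatedDrift G y Γ C₀ lam (ρ t) (β t) (u t) j + barrierForce h τ (u t)) (Set.Ici 0) t

end

end EKI

namespace EKI

lemma antitoneOn_of_hasDerivWithinAt {D : Set ℝ} (hD : Convex ℝ D) {f f' : ℝ → ℝ}
    (hf : ∀ t ∈ D, HasDerivWithinAt f (f' t) D t) (hf' : ∀ t ∈ D, f' t ≤ 0) :
    AntitoneOn f D :=
  antitoneOn_of_hasDerivWithinAt_nonpos hD (fun t ht => (hf t ht).continuousWithinAt)
    (fun t ht => (hf t (interior_subset ht)).mono interior_subset)
    (fun t ht => hf' t (interior_subset ht))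

/-- Decay of nonnegative subsolutions of the Riccati equation `φ' = -a φ²`. -/
lemma le_div_of_deriv_le_neg_sq {φ φ' : ℝ → ℝ} {a M : ℝ} (ha : 0 < a)
    (hM : φ 0 ≤ M) (haM : 1 / a ≤ M)
    (hφ : ∀ t, 0 ≤ t → 0 ≤ φ t)
    (hder : ∀ t, 0 ≤ t → HasDerivWithinAt φ (φ' t) (Set.Ici 0) t)
    (hle : ∀ t, 0 ≤ t → φ' t ≤ -a * φ t ^ 2) {t : ℝ} (ht : 0 ≤ t) :
    φ t ≤ M / (t + 1) := by
  have hMpos : 0 < M := lt_of_lt_of_le (by positivity) haM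
  rcases (hφ t ht).eq_or_lt with h0 | hpos
  · rw [← h0]; positivity
  have hanti : AntitoneOn φ (Set.Ici 0) := antitoneOn_of_hasDerivWithinAt (convex_Ici 0) hder
    (fun s hs => (hle s hs).trans (by nlinarith [sq_nonneg (φ s)]))
  have hp : ∀ s ∈ Set.Icc 0 t, 0 < φ s := fun s hs => hpos.trans_le (hanti hs.1 ht hs.2)
  have key : AntitoneOn (fun s => a * s - (φ s)⁻¹) (Set.Icc 0 t) := by
    refine antitoneOn_of_hasDerivWithinAt (f' := fun s => a * 1 - (-φ' s / φ s ^ 2))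
      (convex_Icc 0 t) (fun s hs => ?_) (fun s hs => ?_)
    · exact ((hasDerivWithinAt_id s _).const_mul a).sub
        (((hder s hs.1).mono Set.Icc_subset_Ici_self).inv (hp s hs).ne')
    · have h1 := hle s hs.1
      have h2 : 0 < φ s ^ 2 := pow_pos (hp s hs) 2
      have : a ≤ -φ' s / φ s ^ 2 := by rw [le_div_iff₀ h2]; linarith
      linarith
  have h := key ⟨le_rfl, ht⟩ ⟨ht, le_rfl⟩ ht
  simp only [mul_zero, zero_sub] at h
  have h0 : M⁻¹ ≤ (φ 0)⁻¹ := inv_anti₀ (hp 0 ⟨le_rfl, ht⟩) hM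
  have h1 : M⁻¹ ≤ a := by
    have := inv_anti₀ (by positivity) haM
    simpa using this
  have h2 : M⁻¹ * (t + 1) ≤ (φ t)⁻¹ := by nlinarith
  rw [le_div_iff₀ (by positivity)]
  have h3 : φ t * (M⁻¹ * (t + 1)) ≤ 1 := by
    calc _ ≤ φ t * (φ t)⁻¹ := by gcongr
      _ = 1 := mul_inv_cancel₀ hpos.ne'
  calc φ t * (t + 1) = M * (φ t * (M⁻¹ * (t + 1))) := by field_simp
    _ ≤ M * 1 := by gcongr
    _ = M := mul_one M

lemma hasDerivWithinAt_add_one_rpow (p : ℝ) {t : ℝ} (ht : 0 ≤ t) (s : Set ℝ) :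
    HasDerivWithinAt (fun x : ℝ => (x + 1) ^ p) (p * (t + 1) ^ (p - 1)) s t := by
  have h : HasDerivAt (fun x : ℝ => x + 1) 1 t := (hasDerivAt_id t).add_const 1
  have := h.rpow_const (p := p) (Or.inl (by positivity))
  simpa using this.hasDerivWithinAt

/-- A Grönwall bound with the integrable coefficient `M / (t + 1)²`. -/
lemma one_add_le_of_deriv_le {f f' : ℝ → ℝ} {M : ℝ} (hM : 0 ≤ M) (hf0 : 0 ≤ 1 + f 0)
    (hder : ∀ t, 0 ≤ t → HasDerivWithinAt f (f' t) (Set.Ici 0) t)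
    (hle : ∀ t, 0 ≤ t → f' t ≤ M / (t + 1) ^ 2 * (1 + f t)) {t : ℝ} (ht : 0 ≤ t) :
    1 + f t ≤ (1 + f 0) * Real.exp M := by
  have key : AntitoneOn (fun s => (1 + f s) * Real.exp (M * (s + 1)⁻¹)) (Set.Ici 0) := by
    refine antitoneOn_of_hasDerivWithinAt
      (f' := fun s => f' s * Real.exp (M * (s + 1)⁻¹) +
        (1 + f s) * (Real.exp (M * (s + 1)⁻¹) * (M * (-1 / (s + 1) ^ 2))))
      (convex_Ici 0) (fun s hs => ?_) (fun s hs => ?_)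
    · have hs' : (0 : ℝ) ≤ s := hs
      have h1 : HasDerivWithinAt (fun x : ℝ => (x + 1)⁻¹) (-1 / (s + 1) ^ 2) (Set.Ici 0) s :=
        ((hasDerivWithinAt_id s _).add_const 1).inv (by simp; positivity)
      exact ((hder s hs).const_add 1).mul (h1.const_mul M).exp
    · have h1 := hle s hs
      have h2 := Real.exp_pos (M * (s + 1)⁻¹)
      have : f' s * Real.exp (M * (s + 1)⁻¹) +
          (1 + f s) * (Real.exp (M * (s + 1)⁻¹) * (M * (-1 / (s + 1) ^ 2))) =
          (f' s - M / (s + 1) ^ 2 * (1 + f s)) * Real.exp (M * (s + 1)⁻¹) := by ring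
      rw [this]
      exact mul_nonpos_of_nonpos_of_nonneg (by linarith) h2.le
  have h := key Set.self_mem_Ici ht ht
  simp only [zero_add, inv_one, mul_one] at h
  by_cases h0 : 0 ≤ 1 + f t
  · refine le_trans ?_ h
    exact le_mul_of_one_le_right h0 (Real.one_le_exp (by positivity))
  · push Not at h0
    exact h0.le.trans (by positivity)

lemma exp_mul_le_of_le_deriv {φ φ' : ℝ → ℝ} {M : ℝ}
    (hder : ∀ t, 0 ≤ t → HasDerivWithinAt φ (φ' t) (Set.Ici 0) t)
    (hle : ∀ t, 0 ≤ t → -M * φ t ≤ φ' t) {t : ℝ} (ht : 0 ≤ t) :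
    φ 0 ≤ φ t * Real.exp (M * t) := by
  have key : AntitoneOn (fun s => -(φ s * Real.exp (M * s))) (Set.Ici 0) := by
    refine antitoneOn_of_hasDerivWithinAt
      (f' := fun s => -(φ' s * Real.exp (M * s) + φ s * (Real.exp (M * s) * (M * 1))))
      (convex_Ici 0) (fun s hs => ?_) (fun s hs => ?_)
    · exact ((hder s hs).mul ((hasDerivWithinAt_id s _).const_mul M).exp).neg
    · have h1 := hle s hs
      have h2 := Real.exp_pos (M * s)
      have := mul_nonneg (by linarith : 0 ≤ φ' s + M * φ s) h2.le
      linarith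
  have h := key Set.self_mem_Ici ht ht
  simp at h
  exact h

/-- Algebraic decay for `g' ≤ -α g / (t + 1) + M / (t + 1)²` with `α < 1`. -/
lemma exists_le_rpow_of_deriv_le {g g' : ℝ → ℝ} {α M T : ℝ} (hα1 : α < 1)
    (hM : 0 ≤ M) (hT : 0 ≤ T)
    (hder : ∀ t, T ≤ t → HasDerivWithinAt g (g' t) (Set.Ici T) t)
    (hle : ∀ t, T ≤ t → g' t ≤ -α * g t / (t + 1) + M / (t + 1) ^ 2) :
    ∃ c : ℝ, 0 < c ∧ ∀ t, T ≤ t → g t ≤ c * (t + 1) ^ (-α) := by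
  have key : AntitoneOn (fun s => g s * (s + 1) ^ α + M / (1 - α) * (s + 1) ^ (α - 1))
      (Set.Ici T) := by
    refine antitoneOn_of_hasDerivWithinAt
      (f' := fun s => (g' s * (s + 1) ^ α + g s * (α * (s + 1) ^ (α - 1))) +
        M / (1 - α) * ((α - 1) * (s + 1) ^ (α - 1 - 1)))
      (convex_Ici T) (fun s hs => ?_) (fun s hs => ?_)
    · have hs' : 0 ≤ s := hT.trans hs
      exact ((hder s hs).mul (hasDerivWithinAt_add_one_rpow α hs' _)).add
        ((hasDerivWithinAt_add_one_rpow (α - 1) hs' _).const_mul _)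
    · have hs1 : 0 < s + 1 := by have : 0 ≤ s := hT.trans hs; positivity
      have h1 := hle s hs
      have h2 := Real.rpow_pos_of_pos hs1 α
      have e1 : (s + 1) ^ (α - 1) = (s + 1) ^ α / (s + 1) := Real.rpow_sub_one hs1.ne' α
      have e2 : (s + 1) ^ (α - 1 - 1) = (s + 1) ^ α / (s + 1) ^ 2 := by
        rw [Real.rpow_sub_one hs1.ne', e1]; field_simp
      have h3 : 1 - α ≠ 0 := by linarith
      have : (g' s * (s + 1) ^ α + g s * (α * (s + 1) ^ (α - 1))) +
        M / (1 - α) * ((α - 1) * (s + 1) ^ (α - 1 - 1)) =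
        (g' s - (-α * g s / (s + 1) + M / (s + 1) ^ 2)) * (s + 1) ^ α := by
        rw [e1, e2]; field_simp; ring
      rw [this]
      exact mul_nonpos_of_nonpos_of_nonneg (by linarith) h2.le
  set c := g T * (T + 1) ^ α + M / (1 - α) * (T + 1) ^ (α - 1)
  refine ⟨max c 1, by positivity, fun t ht => ?_⟩
  have ht1 : 0 < t + 1 := by linarith
  have h := key Set.self_mem_Ici ht ht
  have h2 := Real.rpow_pos_of_pos ht1 α
  have h3 : 0 ≤ M / (1 - α) * (t + 1) ^ (α - 1) :=
    mul_nonneg (div_nonneg hM (by linarith)) (Real.rpow_nonneg ht1.le _)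
  have h4 : g t * (t + 1) ^ α ≤ max c 1 := le_trans (by simp only at h; linarith) (le_max_left _ _)
  rw [Real.rpow_neg ht1.le, ← div_eq_mul_inv, le_div_iff₀ h2]
  exact h4

lemma le_of_deriv_le_add_div {ψ ψ' : ℝ → ℝ} {s ε T : ℝ} (hs : 0 ≤ s) (hε : 0 ≤ ε) (hε1 : ε < 1)
    (hT : 0 ≤ T) (hψT : 0 ≤ ψ T)
    (hder : ∀ t, T ≤ t → HasDerivWithinAt ψ (ψ' t) (Set.Ici T) t)
    (hle : ∀ t, T ≤ t → ψ' t ≤ s + ε * ψ t / (t + 1)) {t : ℝ} (ht : T ≤ t) :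
    ψ t ≤ s / (1 - ε) * (t + 1) + ψ T * (t + 1) ^ ε := by
  have key : AntitoneOn (fun x => ψ x * (x + 1) ^ (-ε) - s / (1 - ε) * (x + 1) ^ (1 - ε))
      (Set.Ici T) := by
    refine antitoneOn_of_hasDerivWithinAt
      (f' := fun x => (ψ' x * (x + 1) ^ (-ε) + ψ x * (-ε * (x + 1) ^ (-ε - 1))) -
        s / (1 - ε) * ((1 - ε) * (x + 1) ^ (1 - ε - 1)))
      (convex_Ici T) (fun x hx => ?_) (fun x hx => ?_)
    · have hx' : 0 ≤ x := hT.trans hx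
      exact ((hder x hx).mul (hasDerivWithinAt_add_one_rpow (-ε) hx' _)).sub
        ((hasDerivWithinAt_add_one_rpow (1 - ε) hx' _).const_mul _)
    · have hx1 : 0 < x + 1 := by have : 0 ≤ x := hT.trans hx; positivity
      have h1 := hle x hx
      have h2 := Real.rpow_pos_of_pos hx1 (-ε)
      have e1 : (x + 1) ^ (-ε - 1) = (x + 1) ^ (-ε) / (x + 1) := Real.rpow_sub_one hx1.ne' (-ε)
      have e2 : (1 - ε - 1) = -ε := by ring
      have h3 : 1 - ε ≠ 0 := by linarith
      have : (ψ' x * (x + 1) ^ (-ε) + ψ x * (-ε * (x + 1) ^ (-ε - 1))) -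
        s / (1 - ε) * ((1 - ε) * (x + 1) ^ (1 - ε - 1)) =
        (ψ' x - (s + ε * ψ x / (x + 1))) * (x + 1) ^ (-ε) := by
        rw [e1, e2]; field_simp; ring
      rw [this]
      exact mul_nonpos_of_nonpos_of_nonneg (by linarith) h2.le
  have hT1 : 0 < T + 1 := by linarith
  have ht1 : 0 < t + 1 := by linarith
  have h := key Set.self_mem_Ici ht ht
  simp only at h
  have h2 := Real.rpow_pos_of_pos ht1 ε
  have h3 : ψ T * (T + 1) ^ (-ε) ≤ ψ T * 1 := by
    gcongr
    exact Real.rpow_le_one_of_one_le_of_nonpos (by linarith) (by linarith)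
  have h4 : 0 ≤ s / (1 - ε) * (T + 1) ^ (1 - ε) :=
    mul_nonneg (div_nonneg hs (by linarith)) (Real.rpow_nonneg hT1.le _)
  have h5 : ψ t * (t + 1) ^ (-ε) ≤ s / (1 - ε) * (t + 1) ^ (1 - ε) + ψ T := by linarith
  have e1 : (t + 1) ^ (-ε) * (t + 1) ^ ε = 1 := by
    rw [← Real.rpow_add ht1]; simp
  have e2 : (t + 1) ^ (1 - ε) * (t + 1) ^ ε = t + 1 := by
    rw [← Real.rpow_add ht1]; simp
  calc ψ t = ψ t * ((t + 1) ^ (-ε) * (t + 1) ^ ε) := by rw [e1, mul_one]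
    _ = ψ t * (t + 1) ^ (-ε) * (t + 1) ^ ε := by ring
    _ ≤ (s / (1 - ε) * (t + 1) ^ (1 - ε) + ψ T) * (t + 1) ^ ε := by gcongr
    _ = s / (1 - ε) * ((t + 1) ^ (1 - ε) * (t + 1) ^ ε) + ψ T * (t + 1) ^ ε := by ring
    _ = _ := by rw [e2]

end EKI

namespace EKI

section Operators

variable {E : Type*} [NormedAddCommGroup E] [InnerProductSpace ℝ E]

/-- Cauchy–Schwarz for a symmetric positive semidefinite operator. -/
lemma sq_inner_apply_le {T : E →L[ℝ] E} (hsymm : ∀ x y, inner ℝ (T x) y = inner ℝ x (T y))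
    (hpos : ∀ x, 0 ≤ inner ℝ x (T x)) (x y : E) :
    inner ℝ x (T y) ^ 2 ≤ inner ℝ x (T x) * inner ℝ y (T y) := by
  have h : ∀ s : ℝ, 0 ≤ inner ℝ y (T y) * (s * s) + 2 * inner ℝ x (T y) * s + inner ℝ x (T x) := by
    intro s
    have h1 := hpos (x + s • y)
    have h2 : inner ℝ y (T x) = inner ℝ x (T y) := by rw [← hsymm, real_inner_comm]
    simp only [map_add, map_smul, inner_add_left, inner_add_right, inner_smul_left,
      inner_smul_right, h2, RCLike.conj_to_real] at h1
    linarith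
  have := discrim_le_zero h
  rw [discrim] at this
  nlinarith

lemma norm_sq_apply_le {T : E →L[ℝ] E} (hsymm : ∀ x y, inner ℝ (T x) y = inner ℝ x (T y))
    (hpos : ∀ x, 0 ≤ inner ℝ x (T x)) {B : ℝ} (hB : ∀ x, inner ℝ x (T x) ≤ B * ‖x‖ ^ 2) (x : E) :
    ‖T x‖ ^ 2 ≤ B * inner ℝ x (T x) := by
  have h := sq_inner_apply_le hsymm hpos (T x) x
  rw [real_inner_self_eq_norm_sq] at h
  rcases eq_or_ne (T x) 0 with h0 | h0
  · simp [h0]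
  have hn : 0 < ‖T x‖ ^ 2 := by positivity
  have h2 := mul_le_mul_of_nonneg_right (hB (T x)) (hpos x)
  nlinarith

lemma inner_apply_le_opNorm (T : E →L[ℝ] E) (x : E) : inner ℝ x (T x) ≤ ‖T‖ * ‖x‖ ^ 2 := by
  calc inner ℝ x (T x) ≤ ‖x‖ * ‖T x‖ := real_inner_le_norm _ _
    _ ≤ ‖x‖ * (‖T‖ * ‖x‖) := by gcongr; exact T.le_opNorm x
    _ = _ := by ring

end Operators

lemma inner_act_comm {n : ℕ} {M : Matrix (Fin n) (Fin n) ℝ} (hM : M.IsHermitian) (x z : Vec n) :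
    inner ℝ (act M x) z = inner ℝ x (act M z) := by
  rw [real_inner_comm, act, Matrix.inner_toEuclideanCLM, Matrix.inner_toEuclideanCLM,
    Matrix.dotProduct_mulVec, ← Matrix.mulVec_transpose, dotProduct_comm]
  have : M.transpose = M := by simpa [Matrix.conjTranspose_eq_transpose_of_trivial] using hM.eq
  rw [this]

lemma inner_act_nonneg {n : ℕ} {M : Matrix (Fin n) (Fin n) ℝ} (hM : M.PosDef) (x : Vec n) :
    0 ≤ inner ℝ x (act M x) := by
  rw [act, Matrix.inner_toEuclideanCLM]
  simpa using hM.posSemidef.dotProduct_mulVec_nonneg (x : Fin n → ℝ)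

lemma exists_coercive_act_inv {n : ℕ} {M : Matrix (Fin n) (Fin n) ℝ} (hM : M.PosDef) :
    ∃ g : ℝ, 0 < g ∧ ∀ x : Vec n, g * ‖x‖ ^ 2 ≤ inner ℝ x (act M⁻¹ x) := by
  refine ⟨(‖act M‖ + 1)⁻¹, by positivity, fun x => ?_⟩
  have hdet : IsUnit M.det := hM.det_pos.ne'.isUnit
  have hx : act M (act M⁻¹ x) = x := by
    have : act M * act M⁻¹ = 1 := by
      rw [act, act, ← map_mul, Matrix.mul_nonsing_inv _ hdet, map_one]
    exact congrArg (fun T => T x) this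
  have h := norm_sq_apply_le (inner_act_comm hM.isHermitian) (inner_act_nonneg hM)
    (inner_apply_le_opNorm (act M)) (act M⁻¹ x)
  rw [hx, real_inner_comm] at h
  have h2 := inner_act_nonneg hM.inv x
  rw [inv_mul_le_iff₀ (by positivity)]
  linarith

section Ensemble

variable {J n k : ℕ}

lemma mean_add (x z : Fin J → Vec n) : mean (fun j => x j + z j) = mean x + mean z := by
  simp [mean, Finset.sum_add_distrib]

lemma mean_sub (x z : Fin J → Vec n) : mean (fun j => x j - z j) = mean x - mean z := by
  simp [mean, Finset.sum_sub_distrib, smul_sub]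

lemma mean_neg (x : Fin J → Vec n) : mean (fun j => -x j) = -mean x := by
  simp [mean]

lemma mean_smul (c : ℝ) (x : Fin J → Vec n) : mean (fun j => c • x j) = c • mean x := by
  simp only [mean, ← Finset.smul_sum, smul_comm c]

lemma mean_const (hJ : 0 < J) (v : Vec n) : mean (fun _ : Fin J => v) = v := by
  simp only [mean, Finset.sum_const, Finset.card_univ, Fintype.card_fin]
  rw [← Nat.cast_smul_eq_nsmul ℝ, smul_smul, one_div, inv_mul_cancel₀ (by positivity), one_smul]

lemma mean_map (T : Vec n →L[ℝ] Vec k) (x : Fin J → Vec n) :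
    mean (fun j => T (x j)) = T (mean x) := by
  simp [mean]

lemma norm_mean_le {x : Fin J → Vec n} {w : Fin J → ℝ} (h : ∀ j, ‖x j‖ ≤ w j) :
    ‖mean x‖ ≤ 1 / (J : ℝ) * ∑ j, w j := by
  rw [mean, norm_smul, Real.norm_of_nonneg (by positivity)]
  gcongr
  exact norm_sum_le_of_le _ fun j _ => h j

lemma mean_sub_mean (hJ : 0 < J) (x : Fin J → Vec n) : mean (fun j => x j - mean x) = 0 := by
  rw [mean_sub, mean_const hJ, sub_self]

lemma sum_sub_mean (hJ : 0 < J) (x : Fin J → Vec n) : ∑ j, (x j - mean x) = 0 := by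
  have h := mean_sub_mean hJ x
  rw [mean, smul_eq_zero] at h
  exact h.resolve_left (by positivity)

lemma inner_crossCov (x : Fin J → Vec n) (z : Fin J → Vec k) (v : Vec n) (w : Vec k) :
    inner ℝ v (crossCov x z w) =
      1 / (J : ℝ) * ∑ j, inner ℝ (x j - mean x) v * inner ℝ (z j - mean z) w := by
  simp only [crossCov, smul_apply, sum_apply,
    InnerProductSpace.rankOne_apply, inner_smul_right, inner_sum]
  congr 1
  refine Finset.sum_congr rfl fun j _ => ?_
  rw [real_inner_comm v]; ring

lemma map_crossCov {l : ℕ} (T : Vec n →L[ℝ] Vec l) (x : Fin J → Vec n) (z : Fin J → Vec k)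
    (w : Vec k) :
    T (crossCov x z w) = (1 / (J : ℝ)) • ∑ j, inner ℝ (z j - mean z) w • T (x j - mean x) := by
  simp only [crossCov, smul_apply, sum_apply, InnerProductSpace.rankOne_apply, map_smul, map_sum]

lemma inner_crossCov_comm (x : Fin J → Vec n) (z : Fin J → Vec k) (v : Vec n) (w : Vec k) :
    inner ℝ (crossCov x z w) v = inner ℝ w (crossCov z x v) := by
  rw [real_inner_comm, inner_crossCov, inner_crossCov]
  simp only [mul_comm]

lemma inner_cov_comm (x : Fin J → Vec n) (v w : Vec n) :
    inner ℝ (cov x v) w = inner ℝ v (cov x w) := inner_crossCov_comm x x w v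

lemma inner_cov (x : Fin J → Vec n) (v : Vec n) :
    inner ℝ v (cov x v) = 1 / (J : ℝ) * ∑ j, inner ℝ (x j - mean x) v ^ 2 := by
  rw [cov, inner_crossCov]; simp only [sq]

lemma inner_cov_nonneg (x : Fin J → Vec n) (v : Vec n) : 0 ≤ inner ℝ v (cov x v) := by
  rw [inner_cov]; positivity

/-- The mean square deviation of an ensemble, that is the trace of its empirical covariance. -/
noncomputable def spread (x : Fin J → Vec n) : ℝ := 1 / (J : ℝ) * ∑ j, ‖x j - mean x‖ ^ 2

lemma spread_nonneg (x : Fin J → Vec n) : 0 ≤ spread x := by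
  unfold spread; positivity

lemma spread_eq_sum (x : Fin J → Vec n) :
    spread x = ∑ a, inner ℝ (EuclideanSpace.basisFun (Fin n) ℝ a)
      (cov x (EuclideanSpace.basisFun (Fin n) ℝ a)) := by
  simp only [inner_cov, ← Finset.mul_sum, spread]
  rw [Finset.sum_comm]
  congr 1
  refine Finset.sum_congr rfl fun j _ => ?_
  rw [← (EuclideanSpace.basisFun (Fin n) ℝ).sum_sq_norm_inner_left]
  simp [sq_abs, real_inner_comm]

lemma norm_sub_mean_sq_le (hJ : 0 < J) (x : Fin J → Vec n) (j : Fin J) :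
    ‖x j - mean x‖ ^ 2 ≤ J * spread x := by
  have h := Finset.single_le_sum (f := fun j => ‖x j - mean x‖ ^ 2)
    (fun i _ => by positivity) (Finset.mem_univ j)
  rw [spread, ← mul_assoc, mul_one_div_cancel (by positivity), one_mul]
  exact h

lemma inner_cov_le (x : Fin J → Vec n) (v : Vec n) :
    inner ℝ v (cov x v) ≤ spread x * ‖v‖ ^ 2 := by
  rw [inner_cov, spread, mul_assoc, Finset.sum_mul]
  gcongr with j
  rw [← mul_pow, ← sq_abs]
  gcongr
  exact abs_real_inner_le_norm _ _

lemma norm_sq_cov_le (x : Fin J → Vec n) (v : Vec n) :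
    ‖cov x v‖ ^ 2 ≤ spread x * inner ℝ v (cov x v) :=
  norm_sq_apply_le (inner_cov_comm x) (inner_cov_nonneg x) (inner_cov_le x) v

lemma norm_sq_crossCov_le (x : Fin J → Vec n) (z : Fin J → Vec k) (v : Vec n) :
    ‖crossCov z x v‖ ^ 2 ≤ spread z * inner ℝ v (cov x v) := by
  rw [← real_inner_self_eq_norm_sq, inner_crossCov]
  set w := crossCov z x v
  rcases eq_or_ne w 0 with h0 | h0
  · simp only [h0, inner_zero_right, zero_mul, Finset.sum_const_zero, mul_zero]
    exact mul_nonneg (spread_nonneg z) (inner_cov_nonneg x v)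
  have hw : 0 < ‖w‖ ^ 2 := by positivity
  have e : 1 / (J : ℝ) * ∑ j, inner ℝ (z j - mean z) w * inner ℝ (x j - mean x) v = ‖w‖ ^ 2 := by
    rw [← inner_crossCov, real_inner_self_eq_norm_sq]
  have h1 := Finset.sum_mul_sq_le_sq_mul_sq Finset.univ
    (fun j => inner ℝ (z j - mean z) w) (fun j => inner ℝ (x j - mean x) v)
  have h2 : (‖w‖ ^ 2) ^ 2 ≤ inner ℝ w (cov z w) * inner ℝ v (cov x v) := by
    rw [← e, inner_cov, inner_cov, mul_pow]
    calc _ ≤ (1 / (J : ℝ)) ^ 2 * _ := mul_le_mul_of_nonneg_left h1 (by positivity)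
      _ = _ := by ring
  have h3 := mul_le_mul_of_nonneg_right (inner_cov_le z w) (inner_cov_nonneg x v)
  rw [e]
  nlinarith

lemma spread_le (hJ : 0 < J) (x : Fin J → Vec n) (c : Vec n) :
    spread x ≤ 1 / (J : ℝ) * ∑ j, ‖x j - c‖ ^ 2 := by
  have h : ∑ j, ‖x j - c‖ ^ 2 = ∑ j, ‖x j - mean x‖ ^ 2 + ∑ _j : Fin J, ‖mean x - c‖ ^ 2 := by
    have h0 : ∑ j, 2 * inner ℝ (x j - mean x) (mean x - c) = 0 := by
      rw [← Finset.mul_sum, ← sum_inner, sum_sub_mean hJ, inner_zero_left, mul_zero]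
    rw [← add_zero (∑ j, ‖x j - mean x‖ ^ 2), ← h0, ← Finset.sum_add_distrib,
      ← Finset.sum_add_distrib]
    refine Finset.sum_congr rfl fun j _ => ?_
    rw [← norm_add_sq_real, sub_add_sub_cancel]
  rw [h, spread]
  gcongr
  exact le_add_of_nonneg_right (by positivity)

/-- Young's inequality for a weighted sum of deviations, with the covariance form absorbing the
direction. -/
lemma mean_inner_mul_le (hJ : 0 < J) (x : Fin J → Vec n) (v : Vec n) (s : Fin J → ℝ) {S η : ℝ}
    (hη : 0 < η) (hs : ∀ j, |s j| ≤ S) :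
    1 / (J : ℝ) * ∑ j, inner ℝ (x j - mean x) v * s j ≤
      η * inner ℝ v (cov x v) + S ^ 2 / (4 * η) := by
  have hS : S ^ 2 / (4 * η) = 1 / (J : ℝ) * ∑ _j : Fin J, S ^ 2 / (4 * η) := by
    simp only [Finset.sum_const, Finset.card_univ, Fintype.card_fin, nsmul_eq_mul]
    field_simp
  rw [hS, inner_cov, mul_left_comm, ← mul_add, Finset.mul_sum Finset.univ _ η,
    ← Finset.sum_add_distrib]
  gcongr with j
  set a := inner ℝ (x j - mean x) v
  have h1 : s j ^ 2 ≤ S ^ 2 := by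
    rw [← sq_abs]; exact pow_le_pow_left₀ (abs_nonneg _) (hs j) 2
  have h2 : a * s j ≤ η * a ^ 2 + s j ^ 2 / (4 * η) := by
    rw [← sub_nonneg]
    have : η * a ^ 2 + s j ^ 2 / (4 * η) - a * s j = (2 * η * a - s j) ^ 2 / (4 * η) := by
      field_simp; ring
    rw [this]; positivity
  exact h2.trans (by gcongr)

end Ensemble

section Drift

variable {d K J : ℕ} (G : Vec d → Vec K) (y : Vec K) (Γ : Matrix (Fin K) (Fin K) ℝ)
  (C₀ : Matrix (Fin d) (Fin d) ℝ) (lam ρ : ℝ) (x : Fin J → Vec d)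

lemma mean_inflatedDrift (hJ : 0 < J) :
    mean (inflatedDrift G y Γ C₀ lam ρ 0 x) =
      -(crossCov x (fun k => G (x k)) (act Γ⁻¹ (mean (fun k => G (x k)) - y)))
        - lam • cov x (act C₀⁻¹ (mean x)) := by
  have : inflatedDrift G y Γ C₀ lam ρ 0 x = fun j =>
    -(crossCov x (fun k => G (x k)) (act Γ⁻¹ (G (x j) - y)))
    - lam • cov x (act C₀⁻¹ (x j))
    + ρ • crossCov x (fun k => G (x k)) (act Γ⁻¹ (G (x j) - mean (fun k => G (x k)))) := by
    ext1 j; simp [inflatedDrift]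
  rw [this, mean_add, mean_sub, mean_neg, mean_smul, mean_smul, mean_map, mean_map, mean_map,
    mean_map, mean_map, mean_map, mean_sub, mean_sub, mean_const hJ, mean_const hJ]
  simp

lemma inflatedDrift_sub_mean (hJ : 0 < J) (j : Fin J) :
    inflatedDrift G y Γ C₀ lam ρ 0 x j - mean (inflatedDrift G y Γ C₀ lam ρ 0 x) =
      -((1 - ρ) • crossCov x (fun k => G (x k)) (act Γ⁻¹ (G (x j) - mean (fun k => G (x k)))))
        - lam • cov x (act C₀⁻¹ (x j - mean x)) := by
  rw [mean_inflatedDrift G y Γ C₀ lam ρ x hJ, inflatedDrift]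
  simp only [map_sub, smul_sub, sub_smul, one_smul, zero_mul, zero_smul]
  abel

/-- The rate of change of `⟨v, Ĉ v⟩` along the flow. -/
lemma covariance_rate (hJ : 0 < J) (v : Vec d) :
    1 / (J : ℝ) * ∑ j, 2 * inner ℝ (x j - mean x) v *
      inner ℝ (inflatedDrift G y Γ C₀ lam ρ 0 x j - mean (inflatedDrift G y Γ C₀ lam ρ 0 x)) v =
    -2 * (1 - ρ) * inner ℝ (crossCov (fun k => G (x k)) x v)
        (act Γ⁻¹ (crossCov (fun k => G (x k)) x v))
      - 2 * lam * inner ℝ (cov x v) (act C₀⁻¹ (cov x v)) := by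
  rw [map_crossCov (act Γ⁻¹), cov, map_crossCov (act C₀⁻¹)]
  simp only [inflatedDrift_sub_mean G y Γ C₀ lam ρ x hJ, inner_sub_left, inner_neg_left,
    inner_smul_left, inner_crossCov_comm, inner_smul_right, inner_sum, RCLike.conj_to_real]
  simp only [Finset.mul_sum, ← Finset.sum_sub_distrib]
  refine Finset.sum_congr rfl fun j _ => ?_
  have hG := inner_crossCov_comm x (fun k => G (x k)) v
    (act Γ⁻¹ (G (x j) - mean fun k => G (x k)))
  rw [← hG, real_inner_comm (crossCov x (fun k => G (x k)) _) v,
    real_inner_comm (crossCov x x _) v, cov]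
  ring

end Drift

end EKI

namespace EKI

section Barrier

variable {d m : ℕ} {Φ : Vec d → ℝ} {h : Fin m → Vec d → ℝ} {τ μ : ℝ}

lemma inner_gradient_le_of_convexOn {f : Vec d → ℝ} (hf : ConvexOn ℝ Set.univ f)
    {x : Vec d} (hd : DifferentiableAt ℝ f x) (w : Vec d) :
    inner ℝ (gradient f x) (w - x) ≤ f w - f x := by
  have hline : HasDerivAt (fun s : ℝ => f (x + s • (w - x))) (fderiv ℝ f x (w - x)) 0 := by
    have h1 : HasDerivAt (fun s : ℝ => x + s • (w - x)) (w - x) 0 := by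
      simpa using ((hasDerivAt_id (0 : ℝ)).smul_const (w - x)).const_add x
    have h2 : HasFDerivAt f (fderiv ℝ f x) (x + (0 : ℝ) • (w - x)) := by
      simpa using hd.hasFDerivAt
    exact h2.comp_hasDerivAt 0 h1
  have hconv : ConvexOn ℝ Set.univ (fun s : ℝ => f (x + s • (w - x))) := by
    have : ConvexOn ℝ Set.univ (f ∘ (AffineMap.lineMap x w : ℝ →ᵃ[ℝ] Vec d)) :=
      hf.comp_affineMap _
    convert this using 2 with s
    simp [AffineMap.lineMap_apply, add_comm]
  have h := hconv.le_slope_of_hasDerivAt (Set.mem_univ 0) (Set.mem_univ 1) one_pos hline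
  rw [inner_gradient_left]
  simpa [slope_def_field] using h

/-- The gradient of the log-barrier potential at strictly feasible points. -/
noncomputable def barrierGrad (Φ : Vec d → ℝ) (h : Fin m → Vec d → ℝ) (τ : ℝ) (x : Vec d) :
    Vec d :=
  gradient Φ x - (1 / τ) • ∑ i, (1 / h i x) • gradient (h i) x

lemma inner_barrierGrad (x v : Vec d) :
    inner ℝ (barrierGrad Φ h τ x) v =
      inner ℝ (gradient Φ x) v - 1 / τ * ∑ i, 1 / h i x * inner ℝ (gradient (h i) x) v := by
  simp [barrierGrad, inner_sub_left, inner_smul_left, sum_inner]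

lemma hasGradientAt_barrierPotential (hΦ : Differentiable ℝ Φ) (hh : ∀ i, Differentiable ℝ (h i))
    {x : Vec d} (hx : StrictlyFeasible h x) :
    HasGradientAt (barrierPotential Φ h τ) (barrierGrad Φ h τ x) x := by
  rw [hasGradientAt_iff_hasFDerivAt]
  have h1 : ∀ i ∈ Finset.univ, HasFDerivAt (fun z => Real.log (-(h i z)))
      ((-(h i x))⁻¹ • -(fderiv ℝ (h i) x)) x := fun i _ =>
    ((hh i x).hasFDerivAt.neg).log (neg_ne_zero.mpr (hx i).ne)
  have h2 := (hΦ x).hasFDerivAt.sub ((HasFDerivAt.fun_sum h1).const_mul (1 / τ))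
  refine h2.congr_fderiv ?_
  ext v
  simp only [InnerProductSpace.toDual_apply_apply, inner_barrierGrad, inner_gradient_left]
  simp [inv_neg, sub_eq_add_neg]

lemma barrierPotential_strongConvex (hτ : 0 < τ)
    (hconv : ∀ x₁ x₂ : Vec d, inner ℝ (gradient Φ x₂) (x₁ - x₂) + μ / 2 * ‖x₁ - x₂‖ ^ 2
      ≤ Φ x₁ - Φ x₂)
    (hhconv : ∀ i, ConvexOn ℝ Set.univ (h i)) (hh : ∀ i, Differentiable ℝ (h i))
    {x w : Vec d} (hx : StrictlyFeasible h x) (hw : StrictlyFeasible h w) :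
    inner ℝ (barrierGrad Φ h τ x) (w - x) + μ / 2 * ‖w - x‖ ^ 2 ≤
      barrierPotential Φ h τ w - barrierPotential Φ h τ x := by
  have h1 : ∀ i, Real.log (-(h i w)) - Real.log (-(h i x)) ≤
      1 / h i x * inner ℝ (gradient (h i) x) (w - x) := by
    intro i
    have hxi := hx i
    have hwi := hw i
    rw [← Real.log_div (by linarith) (by linarith), neg_div_neg_eq]
    have hpos : 0 < h i w / h i x := div_pos_of_neg_of_neg hwi hxi
    have hg := inner_gradient_le_of_convexOn (hhconv i) (hh i x) w
    calc Real.log (h i w / h i x) ≤ h i w / h i x - 1 := Real.log_le_sub_one_of_pos hpos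
      _ = 1 / h i x * (h i w - h i x) := by field_simp [hxi.ne]
      _ ≤ _ := mul_le_mul_of_nonpos_left hg (by rw [one_div]; exact (inv_lt_zero.mpr hxi).le)
  have h2 := Finset.sum_le_sum fun i (_ : i ∈ Finset.univ) => h1 i
  rw [Finset.sum_sub_distrib] at h2
  have h3 := mul_le_mul_of_nonneg_left h2 (by positivity : 0 ≤ 1 / τ)
  have h4 := hconv w x
  rw [inner_barrierGrad]
  simp only [barrierPotential]
  linarith

/-- The Polyak–Łojasiewicz inequality for the log-barrier potential. -/
lemma barrierPotential_PL (hτ : 0 < τ) (hμ : 0 < μ)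
    (hconv : ∀ x₁ x₂ : Vec d, inner ℝ (gradient Φ x₂) (x₁ - x₂) + μ / 2 * ‖x₁ - x₂‖ ^ 2
      ≤ Φ x₁ - Φ x₂)
    (hhconv : ∀ i, ConvexOn ℝ Set.univ (h i)) (hh : ∀ i, Differentiable ℝ (h i))
    {x w : Vec d} (hx : StrictlyFeasible h x) (hw : StrictlyFeasible h w) :
    2 * μ * (barrierPotential Φ h τ x - barrierPotential Φ h τ w) ≤
      ‖barrierGrad Φ h τ x‖ ^ 2 := by
  have h1 := barrierPotential_strongConvex hτ hconv hhconv hh hx hw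
  have h2 : 0 ≤ ‖barrierGrad Φ h τ x + μ • (w - x)‖ ^ 2 := by positivity
  rw [norm_add_sq_real, inner_smul_right, norm_smul, Real.norm_of_nonneg hμ.le] at h2
  nlinarith

lemma barrierGrad_eq_zero (hΦ : Differentiable ℝ Φ) (hh : ∀ i, Differentiable ℝ (h i))
    {v : Vec d} (hv : IsBarrierMinimiser Φ h τ v) : barrierGrad Φ h τ v = 0 := by
  have hnhds : ∀ᶠ z in 𝓝 v, StrictlyFeasible h z := by
    simp only [StrictlyFeasible]
    rw [eventually_all]
    exact fun i => (hh i).continuous.continuousAt.eventually_lt continuousAt_const (hv.1 i)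
  have hmin : IsLocalMin (barrierPotential Φ h τ) v := hnhds.mono fun z hz => hv.2 z hz
  have hg := hasGradientAt_barrierPotential (τ := τ) hΦ hh hv.1
  have := hmin.hasFDerivAt_eq_zero (hasGradientAt_iff_hasFDerivAt.mp hg)
  simpa using this

lemma norm_sq_sub_minimiser_le (hτ : 0 < τ)
    (hΦ : Differentiable ℝ Φ)
    (hconv : ∀ x₁ x₂ : Vec d, inner ℝ (gradient Φ x₂) (x₁ - x₂) + μ / 2 * ‖x₁ - x₂‖ ^ 2
      ≤ Φ x₁ - Φ x₂)
    (hhconv : ∀ i, ConvexOn ℝ Set.univ (h i)) (hh : ∀ i, Differentiable ℝ (h i))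
    {v w : Vec d} (hv : IsBarrierMinimiser Φ h τ v) (hw : StrictlyFeasible h w) :
    μ / 2 * ‖w - v‖ ^ 2 ≤ barrierPotential Φ h τ w - barrierPotential Φ h τ v := by
  have h1 := barrierPotential_strongConvex hτ hconv hhconv hh hv.1 hw
  rwa [barrierGrad_eq_zero hΦ hh hv, inner_zero_left, zero_add] at h1

end Barrier

section Forward

variable {d K : ℕ} {G : Vec d → Vec K} {y : Vec K} {Γ : Matrix (Fin K) (Fin K) ℝ}
  {C₀ : Matrix (Fin d) (Fin d) ℝ} {lam μ L b : ℝ}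

lemma inner_gradient_regPotential (hΓ : Γ.PosDef) (hC₀ : C₀.PosDef) (hG : Differentiable ℝ G)
    (x v : Vec d) :
    inner ℝ (gradient (regPotential G y Γ C₀ lam) x) v =
      inner ℝ (fderiv ℝ G x v) (act Γ⁻¹ (G x - y)) + lam * inner ℝ v (act C₀⁻¹ x) := by
  have h1 : HasFDerivAt (fun z => G z - y) (fderiv ℝ G x) x := (hG x).hasFDerivAt.sub_const y
  have h2 : HasFDerivAt (fun z => act Γ⁻¹ (G z - y)) ((act Γ⁻¹).comp (fderiv ℝ G x)) x :=
    (act Γ⁻¹).hasFDerivAt.comp x h1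
  have h3 : HasFDerivAt (fun z : Vec d => act C₀⁻¹ z) (act C₀⁻¹) x := (act C₀⁻¹).hasFDerivAt
  have h4 := ((h1.inner ℝ h2).const_mul (1 / 2)).add
    (((hasFDerivAt_id x).inner ℝ h3).const_mul (lam / 2))
  have h5 : HasFDerivAt (regPotential G y Γ C₀ lam) _ x := h4
  rw [inner_gradient_left, h5.fderiv]
  have e1 := inner_act_comm hΓ.inv.isHermitian (fderiv ℝ G x v) (G x - y)
  have e2 := inner_act_comm hC₀.inv.isHermitian v x
  rw [real_inner_comm] at e1 e2
  simp [fderivInnerCLM_apply, -map_sub]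
  rw [e1, e2]
  ring

lemma exists_linear_growth (hΓ : Γ.PosDef) (hC₀ : C₀.PosDef) (hlam : 0 < lam)
    (hμ : 0 < μ)
    (hconv : ∀ x₁ x₂ : Vec d,
      inner ℝ (gradient (regPotential G y Γ C₀ lam) x₂) (x₁ - x₂) + μ / 2 * ‖x₁ - x₂‖ ^ 2
        ≤ regPotential G y Γ C₀ lam x₁ - regPotential G y Γ C₀ lam x₂)
    (hL : 0 < L)
    (hsmooth : ∀ x₁ x₂ : Vec d,
      ‖gradient (regPotential G y Γ C₀ lam) x₁ - gradient (regPotential G y Γ C₀ lam) x₂‖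
        ≤ L * ‖x₁ - x₂‖) (hb : 0 ≤ b)
    (hres : ∀ x₁ x₂ : Vec d, ‖G x₁ - G x₂ - fderiv ℝ G x₂ (x₁ - x₂)‖ ≤ b * ‖x₁ - x₂‖ ^ 2) :
    ∃ M : ℝ, 0 ≤ M ∧ ∀ x, ‖G x - y‖ ≤ M * (1 + ‖x‖) ∧ ‖fderiv ℝ G x‖ ≤ M * (1 + ‖x‖) := by
  obtain ⟨g, hg, hcoer⟩ := exists_coercive_act_inv hΓ
  set Φ := regPotential G y Γ C₀ lam
  set B := |Φ 0| + ‖gradient Φ 0‖ + L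
  have hB : 0 ≤ B := by positivity
  set M₀ := 2 * B / g + 1
  have hM₀ : 1 ≤ M₀ := le_add_of_nonneg_left (by positivity)
  have hGx : ∀ x, ‖G x - y‖ ≤ M₀ * (1 + ‖x‖) := by
    intro x
    have h1 := hconv 0 x
    rw [zero_sub, inner_neg_right, norm_neg] at h1
    have h2 : inner ℝ (gradient Φ x) x ≤ (‖gradient Φ 0‖ + L * ‖x‖) * ‖x‖ := by
      refine (real_inner_le_norm _ _).trans ?_
      gcongr
      have h3 := hsmooth x 0
      rw [sub_zero] at h3
      calc ‖gradient Φ x‖ = ‖gradient Φ 0 + (gradient Φ x - gradient Φ 0)‖ := by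
            rw [add_sub_cancel]
        _ ≤ _ := (norm_add_le _ _).trans (by gcongr)
    have h3 : Φ x ≤ B * (1 + ‖x‖) ^ 2 := by
      have h4 : 0 ≤ μ / 2 * ‖x‖ ^ 2 := by positivity
      have h5 := le_abs_self (Φ 0)
      have h6 := norm_nonneg x
      have h7 := norm_nonneg (gradient Φ 0)
      have h8 := abs_nonneg (Φ 0)
      have : B * (1 + ‖x‖) ^ 2 = |Φ 0| + |Φ 0| * (2 * ‖x‖ + ‖x‖ ^ 2) + ‖gradient Φ 0‖ * ‖x‖
        + ‖gradient Φ 0‖ * (1 + ‖x‖ + ‖x‖ ^ 2) + L * ‖x‖ ^ 2 + L * (1 + 2 * ‖x‖) := by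
        simp only [B]; ring
      have p1 : 0 ≤ |Φ 0| * (2 * ‖x‖ + ‖x‖ ^ 2) := by positivity
      have p2 : 0 ≤ ‖gradient Φ 0‖ * (1 + ‖x‖ + ‖x‖ ^ 2) := by positivity
      have p3 : 0 ≤ L * (1 + 2 * ‖x‖) := by positivity
      nlinarith
    have h4 : 1 / 2 * (g * ‖G x - y‖ ^ 2) ≤ Φ x := by
      have h5 := hcoer (G x - y)
      have h6 : 0 ≤ lam / 2 * inner ℝ x (act C₀⁻¹ x) :=
        mul_nonneg (by positivity) (inner_act_nonneg hC₀.inv x)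
      simp only [Φ, regPotential]
      linarith
    have h5 : ‖G x - y‖ ^ 2 ≤ (M₀ * (1 + ‖x‖)) ^ 2 := by
      have h6 : g * ‖G x - y‖ ^ 2 ≤ 2 * B * (1 + ‖x‖) ^ 2 := by linarith
      have h7 : ‖G x - y‖ ^ 2 ≤ 2 * B / g * (1 + ‖x‖) ^ 2 := by
        rw [div_mul_eq_mul_div, le_div_iff₀ hg]; linarith
      rw [mul_pow]
      refine h7.trans ?_
      gcongr
      calc 2 * B / g ≤ M₀ := by simp [M₀]
        _ ≤ M₀ ^ 2 := by nlinarith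
    exact le_of_sq_le_sq h5 (by positivity)
  refine ⟨3 * M₀ + b, by positivity, fun x => ⟨(hGx x).trans ?_, ?_⟩⟩
  · gcongr
    linarith
  · refine ContinuousLinearMap.opNorm_le_of_unit_norm (by positivity) fun v hv => ?_
    have h1 := hres (x + v) x
    rw [add_sub_cancel_left, hv, one_pow, mul_one] at h1
    have h2 := hGx (x + v)
    have h3 := hGx x
    have h4 : ‖x + v‖ ≤ ‖x‖ + 1 := (norm_add_le _ _).trans (by rw [hv])
    have h5 : fderiv ℝ G x v =
        (G (x + v) - y) - (G x - y) - (G (x + v) - G x - fderiv ℝ G x v) := by abel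
    rw [h5]
    have h6 : M₀ * (1 + ‖x + v‖) ≤ M₀ * (1 + (‖x‖ + 1)) := by gcongr
    have h7 := norm_nonneg x
    refine (norm_sub_le_of_le (norm_sub_le_of_le (h2.trans h6) h3) h1).trans ?_
    nlinarith

end Forward

section EnsembleForward

variable {d K J : ℕ} {G : Vec d → Vec K} {b : ℝ}

lemma norm_mean_map_sub_le (hJ : 0 < J)
    (hres : ∀ x₁ x₂ : Vec d, ‖G x₁ - G x₂ - fderiv ℝ G x₂ (x₁ - x₂)‖ ≤ b * ‖x₁ - x₂‖ ^ 2)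
    (x : Fin J → Vec d) :
    ‖mean (fun k => G (x k)) - G (mean x)‖ ≤ b * spread x := by
  have h : mean (fun k => G (x k)) - G (mean x) =
      mean (fun k => G (x k) - G (mean x) - fderiv ℝ G (mean x) (x k - mean x)) := by
    rw [mean_sub, mean_sub, mean_const hJ, mean_map, mean_sub_mean hJ, map_zero, sub_zero]
  rw [h]
  refine (norm_mean_le fun j => hres (x j) (mean x)).trans_eq ?_
  rw [spread, ← Finset.mul_sum]; ring

lemma spread_map_le (hJ : 0 < J) (hb : 0 ≤ b)
    (hres : ∀ x₁ x₂ : Vec d, ‖G x₁ - G x₂ - fderiv ℝ G x₂ (x₁ - x₂)‖ ≤ b * ‖x₁ - x₂‖ ^ 2)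
    {x : Fin J → Vec d} {a q₀ : ℝ} (ha : ‖fderiv ℝ G (mean x)‖ ≤ a) (hq : spread x ≤ q₀) :
    spread (fun k => G (x k)) ≤ (a + b * (1 + J * q₀)) ^ 2 * spread x := by
  refine (spread_le hJ _ (G (mean x))).trans ?_
  have hq0 : 0 ≤ q₀ := (spread_nonneg x).trans hq
  rw [spread, mul_left_comm, Finset.mul_sum Finset.univ _ ((a + b * (1 + J * q₀)) ^ 2)]
  gcongr with j
  rw [← mul_pow]
  gcongr
  set e := x j - mean x
  have h1 := hres (x j) (mean x)
  have h2 : ‖e‖ ≤ 1 + J * q₀ := by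
    have h3 := norm_sub_mean_sq_le hJ x j
    have h4 : (J : ℝ) * spread x ≤ J * q₀ := by gcongr
    nlinarith [sq_nonneg (‖e‖ - 1), norm_nonneg e]
  have h3 : ‖fderiv ℝ G (mean x) e‖ ≤ a * ‖e‖ :=
    ((fderiv ℝ G (mean x)).le_opNorm e).trans (by gcongr)
  calc ‖G (x j) - G (mean x)‖
      = ‖(G (x j) - G (mean x) - fderiv ℝ G (mean x) e) + fderiv ℝ G (mean x) e‖ := by
        rw [sub_add_cancel]
    _ ≤ b * ‖e‖ ^ 2 + a * ‖e‖ := norm_add_le_of_le h1 h3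
    _ = (a + b * ‖e‖) * ‖e‖ := by ring
    _ ≤ _ := by gcongr

/-- The discrepancy between the data-misfit drift and the preconditioned gradient, tested against
the deviation of particle `j`. -/
noncomputable def linearisationError (G : Vec d → Vec K) (y : Vec K)
    (Γ : Matrix (Fin K) (Fin K) ℝ) (x : Fin J → Vec d) (j : Fin J) : ℝ :=
  inner ℝ (fderiv ℝ G (mean x) (x j - mean x)) (act Γ⁻¹ (G (mean x) - y))
    - inner ℝ (G (x j) - G (mean x)) (act Γ⁻¹ (mean (fun k => G (x k)) - y))

lemma abs_linearisationError_le (hJ : 0 < J) (y : Vec K) (Γ : Matrix (Fin K) (Fin K) ℝ)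
    (hb : 0 ≤ b)
    (hres : ∀ x₁ x₂ : Vec d, ‖G x₁ - G x₂ - fderiv ℝ G x₂ (x₁ - x₂)‖ ≤ b * ‖x₁ - x₂‖ ^ 2)
    {M q₀ : ℝ} (hM : 0 ≤ M)
    (hgrowth : ∀ x, ‖G x - y‖ ≤ M * (1 + ‖x‖) ∧ ‖fderiv ℝ G x‖ ≤ M * (1 + ‖x‖))
    {x : Fin J → Vec d} (hq : spread x ≤ q₀) (j : Fin J) :
    |linearisationError G y Γ x j| ≤
      ‖act Γ⁻¹‖ * b * (M * (1 + J * q₀) + J * (M + b * q₀)) * spread x * (1 + ‖mean x‖) := by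
  set e := x j - mean x with he
  set P := act Γ⁻¹
  set Gm := mean (fun k => G (x k)) with hGm
  have hs := spread_nonneg x
  have hq0 : 0 ≤ q₀ := hs.trans hq
  have heq : linearisationError G y Γ x j =
      inner ℝ (fderiv ℝ G (mean x) e) (P (G (mean x) - Gm))
        - inner ℝ (G (x j) - G (mean x) - fderiv ℝ G (mean x) e) (P (Gm - y)) := by
    simp only [linearisationError, inner_sub_left, map_sub, inner_sub_right, P, ← he, ← hGm]
    ring
  have h1 := hres (x j) (mean x)
  have h3 := norm_sub_mean_sq_le hJ x j
  have h2 : ‖e‖ ≤ 1 + J * q₀ := by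
    have h4 : (J : ℝ) * spread x ≤ J * q₀ := by gcongr
    nlinarith [sq_nonneg (‖e‖ - 1), norm_nonneg e]
  have h4 := norm_mean_map_sub_le hJ hres x
  have h5 : ‖Gm - y‖ ≤ (M + b * q₀) * (1 + ‖mean x‖) := by
    have h6 : ‖Gm - y‖ ≤ b * q₀ + M * (1 + ‖mean x‖) := by
      rw [← sub_add_sub_cancel Gm (G (mean x)) y]
      exact norm_add_le_of_le (h4.trans (by gcongr)) (hgrowth _).1
    have h7 : 0 ≤ b * q₀ * ‖mean x‖ := by positivity
    linarith
  have h6 : |inner ℝ (fderiv ℝ G (mean x) e) (P (G (mean x) - Gm))| ≤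
      (M * (1 + ‖mean x‖) * (1 + J * q₀)) * (‖P‖ * (b * spread x)) := by
    refine (abs_real_inner_le_norm _ _).trans ?_
    gcongr
    · exact ((fderiv ℝ G (mean x)).le_opNorm e).trans (by gcongr; exact (hgrowth _).2)
    · refine (P.le_opNorm _).trans ?_
      rw [norm_sub_rev]
      gcongr
  have h7 : |inner ℝ (G (x j) - G (mean x) - fderiv ℝ G (mean x) e) (P (Gm - y))| ≤
      (b * (J * spread x)) * (‖P‖ * ((M + b * q₀) * (1 + ‖mean x‖))) := by
    refine (abs_real_inner_le_norm _ _).trans ?_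
    gcongr
    · exact h1.trans (by gcongr)
    · exact (P.le_opNorm _).trans (by gcongr)
  rw [heq]
  refine (abs_sub _ _).trans ((add_le_add h6 h7).trans_eq ?_)
  ring

/-- The decay rate of the barrier potential along the mean of the flow. -/
lemma inner_barrierGrad_mean_drift {m : ℕ} (hJ : 0 < J) (hG : Differentiable ℝ G) (y : Vec K)
    {Γ : Matrix (Fin K) (Fin K) ℝ} (hΓ : Γ.PosDef) {C₀ : Matrix (Fin d) (Fin d) ℝ}
    (hC₀ : C₀.PosDef) (lam ρ : ℝ) (h : Fin m → Vec d → ℝ) (τ : ℝ) (x : Fin J → Vec d) :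
    inner ℝ (barrierGrad (regPotential G y Γ C₀ lam) h τ (mean x))
        (mean (inflatedDrift G y Γ C₀ lam ρ 0 x) + barrierForce h τ x) =
      -inner ℝ (barrierGrad (regPotential G y Γ C₀ lam) h τ (mean x))
          (cov x (barrierGrad (regPotential G y Γ C₀ lam) h τ (mean x)))
        + 1 / (J : ℝ) * ∑ j, inner ℝ (x j - mean x)
            (barrierGrad (regPotential G y Γ C₀ lam) h τ (mean x)) *
          linearisationError G y Γ x j := by
  set n := barrierGrad (regPotential G y Γ C₀ lam) h τ (mean x) with hn
  set Gm := mean (fun k => G (x k)) with hGm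
  have hforce : barrierForce h τ x =
      cov x (gradient (regPotential G y Γ C₀ lam) (mean x)) - cov x n := by
    rw [← map_sub, hn, barrierGrad, sub_sub_cancel, map_smul, barrierForce]
  have hzero : ∑ j, inner ℝ (x j - mean x) n *
      -inner ℝ (G (mean x) - Gm) (act Γ⁻¹ (Gm - y)) = 0 := by
    rw [← Finset.sum_mul, ← sum_inner, sum_sub_mean hJ, inner_zero_left, zero_mul]
  have hmain : inner ℝ n (cov x (gradient (regPotential G y Γ C₀ lam) (mean x)))
      - inner ℝ n (crossCov x (fun k => G (x k)) (act Γ⁻¹ (Gm - y)))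
      - lam * inner ℝ n (cov x (act C₀⁻¹ (mean x))) =
      1 / (J : ℝ) * ∑ j, inner ℝ (x j - mean x) n * linearisationError G y Γ x j := by
    rw [← add_zero (∑ j, inner ℝ (x j - mean x) n * linearisationError G y Γ x j), ← hzero,
      ← Finset.sum_add_distrib, cov, inner_crossCov, inner_crossCov, inner_crossCov,
      mul_left_comm lam, ← mul_sub, ← mul_sub, Finset.mul_sum Finset.univ _ lam,
      ← Finset.sum_sub_distrib, ← Finset.sum_sub_distrib]
    congr 1
    refine Finset.sum_congr rfl fun j _ => ?_
    rw [real_inner_comm (gradient _ _), inner_gradient_regPotential hΓ hC₀ hG, linearisationError,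
      ← hGm]
    have : inner ℝ (G (x j) - Gm) (act Γ⁻¹ (Gm - y)) =
        inner ℝ (G (x j) - G (mean x)) (act Γ⁻¹ (Gm - y))
          + inner ℝ (G (mean x) - Gm) (act Γ⁻¹ (Gm - y)) := by
      rw [← inner_add_left, sub_add_sub_cancel]
    rw [this]
    ring
  rw [← hmain, mean_inflatedDrift G y Γ C₀ lam ρ x hJ, hforce]
  simp only [inner_add_right, inner_sub_right, inner_neg_right, inner_smul_right, ← hGm]
  ring

end EnsembleForward

end EKI

namespace EKI

/-- The rate of `⟨v, C⁻¹ v⟩` for a symmetric invertible family `C`, in terms of the rates `r` of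
the quadratic forms of `C`. -/
lemma hasDerivWithinAt_inner_inverse {E : Type*} [NormedAddCommGroup E] [InnerProductSpace ℝ E]
    [CompleteSpace E] {C : ℝ → E →L[ℝ] E} {r : E → ℝ} {s : Set ℝ} {t : ℝ}
    (hs : UniqueDiffWithinAt ℝ s t) (hC : DifferentiableWithinAt ℝ C s t) (hunit : IsUnit (C t))
    (hsymm : ∀ x y, inner ℝ (C t x) y = inner ℝ x (C t y))
    (hr : ∀ v, HasDerivWithinAt (fun a => inner ℝ v (C a v)) (r v) s t) (v : E) :
    HasDerivWithinAt (fun a => inner ℝ v (Ring.inverse (C a) v))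
      (-r (Ring.inverse (C t) v)) s t := by
  obtain ⟨U, hU⟩ := hunit
  have hC' := hC.hasDerivWithinAt
  set C' := derivWithin C s t
  have hrate : ∀ w, r w = inner ℝ w (C' w) := by
    intro w
    have h1 : HasDerivWithinAt (fun a => inner ℝ w (C a w)) (inner ℝ w (C' w)) s t := by
      have h2 : HasDerivWithinAt (fun a => C a w) (C' w) s t := by
        simpa using hC'.clm_apply (hasDerivWithinAt_const t s w)
      simpa using (hasDerivWithinAt_const t s w).inner ℝ h2
    exact hs.eq_deriv _ (hr w) h1
  have hinv : HasDerivWithinAt (fun a => Ring.inverse (C a)) (-(↑U⁻¹ * C' * ↑U⁻¹)) s t := by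
    have h1 := hasFDerivAt_ringInverse (𝕜 := ℝ) U
    rw [hU] at h1
    exact (h1.comp_hasDerivWithinAt t hC').congr_deriv (by simp)
  have h2 : HasDerivWithinAt (fun a => Ring.inverse (C a) v)
      ((-(↑U⁻¹ * C' * ↑U⁻¹) : E →L[ℝ] E) v) s t := by
    simpa using hinv.clm_apply (hasDerivWithinAt_const t s v)
  have h3 : HasDerivWithinAt (fun a => inner ℝ v (Ring.inverse (C a) v))
      (inner ℝ v ((-(↑U⁻¹ * C' * ↑U⁻¹) : E →L[ℝ] E) v)) s t := by
    simpa using (hasDerivWithinAt_const t s v).inner ℝ h2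
  convert h3 using 1
  have hCU : ∀ x, C t ((↑U⁻¹ : E →L[ℝ] E) x) = x := fun x => by
    rw [← hU]
    exact congrArg (fun T : E →L[ℝ] E => T x) U.mul_inv
  rw [hrate, ← hU, Ring.inverse_unit]
  simp only [neg_apply, inner_neg_right, mul_apply_eq_comp]
  congr 1
  conv_rhs => rw [← hCU v, hsymm, hCU, hCU]

lemma isBoundedBilinearMap_rankOne {E : Type*} [NormedAddCommGroup E] [InnerProductSpace ℝ E] :
    IsBoundedBilinearMap ℝ (fun p : E × E => InnerProductSpace.rankOne ℝ p.1 p.2) :=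
  { add_left := fun x₁ x₂ z => by simp
    smul_left := fun c x z => by simp
    add_right := fun x z₁ z₂ => by simp
    smul_right := fun c x z => by simp
    bound := ⟨1, one_pos, fun x z => by simp⟩ }

lemma differentiableWithinAt_rankOne_self {E : Type*} [NormedAddCommGroup E]
    [InnerProductSpace ℝ E] {e : ℝ → E} {s : Set ℝ} {t : ℝ}
    (he : DifferentiableWithinAt ℝ e s t) :
    DifferentiableWithinAt ℝ (fun a => InnerProductSpace.rankOne ℝ (e a) (e a)) s t :=
  DifferentiableAt.comp_differentiableWithinAt
    (g := fun p : E × E => InnerProductSpace.rankOne ℝ p.1 p.2) t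
    (isBoundedBilinearMap_rankOne.differentiableAt (e t, e t)) (he.prodMk he)

section Flow

variable {d K m J : ℕ} {G : Vec d → Vec K} {y : Vec K} {Γ : Matrix (Fin K) (Fin K) ℝ}
  {C₀ : Matrix (Fin d) (Fin d) ℝ} {lam : ℝ} {h : Fin m → Vec d → ℝ} {τ : ℝ} {ρ : ℝ → ℝ}
  {u : ℝ → Fin J → Vec d}

lemma IsFlowSolution.hasDerivWithinAt_mean
    (hu : IsFlowSolution G y Γ C₀ lam h τ ρ (fun _ => 0) u) (hJ : 0 < J) {t : ℝ} (ht : 0 ≤ t) :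
    HasDerivWithinAt (fun s => mean (u s))
      (mean (inflatedDrift G y Γ C₀ lam (ρ t) 0 (u t)) + barrierForce h τ (u t))
      (Set.Ici 0) t := by
  have h1 := (HasDerivWithinAt.fun_sum fun j (_ : j ∈ Finset.univ) =>
    hu.hasDeriv t ht j).const_smul (1 / (J : ℝ))
  refine HasDerivWithinAt.congr_deriv h1 ?_
  have h2 := mean_add (inflatedDrift G y Γ C₀ lam (ρ t) 0 (u t)) (fun _ => barrierForce h τ (u t))
  rwa [mean_const hJ] at h2

lemma IsFlowSolution.hasDerivWithinAt_sub_mean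
    (hu : IsFlowSolution G y Γ C₀ lam h τ ρ (fun _ => 0) u) (hJ : 0 < J) {t : ℝ} (ht : 0 ≤ t)
    (j : Fin J) :
    HasDerivWithinAt (fun s => u s j - mean (u s))
      (inflatedDrift G y Γ C₀ lam (ρ t) 0 (u t) j
        - mean (inflatedDrift G y Γ C₀ lam (ρ t) 0 (u t))) (Set.Ici 0) t :=
  ((hu.hasDeriv t ht j).sub (hu.hasDerivWithinAt_mean hJ ht)).congr_deriv
    (add_sub_add_right_eq_sub _ _ _)

/-- The rate of change of `⟨v, Ĉ v⟩` under the flow at the ensemble `x`. -/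
noncomputable def covRate (G : Vec d → Vec K) (Γ : Matrix (Fin K) (Fin K) ℝ)
    (C₀ : Matrix (Fin d) (Fin d) ℝ) (lam ρ : ℝ) (x : Fin J → Vec d) (v : Vec d) : ℝ :=
  -2 * (1 - ρ) * inner ℝ (crossCov (fun k => G (x k)) x v)
      (act Γ⁻¹ (crossCov (fun k => G (x k)) x v))
    - 2 * lam * inner ℝ (cov x v) (act C₀⁻¹ (cov x v))

lemma IsFlowSolution.hasDerivWithinAt_inner_cov
    (hu : IsFlowSolution G y Γ C₀ lam h τ ρ (fun _ => 0) u) (hJ : 0 < J) {t : ℝ} (ht : 0 ≤ t)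
    (v : Vec d) :
    HasDerivWithinAt (fun s => inner ℝ v (cov (u s) v))
      (covRate G Γ C₀ lam (ρ t) (u t) v) (Set.Ici 0) t := by
  simp only [inner_cov]
  rw [covRate, ← covariance_rate G y Γ C₀ lam (ρ t) (u t) hJ v]
  refine (HasDerivWithinAt.fun_sum fun j _ => ?_).const_mul _
  have h1 := (hu.hasDerivWithinAt_sub_mean hJ ht j).inner ℝ (hasDerivWithinAt_const t _ v)
  exact (h1.pow 2).congr_deriv (by simp)

lemma IsFlowSolution.differentiableWithinAt_cov
    (hu : IsFlowSolution G y Γ C₀ lam h τ ρ (fun _ => 0) u) (hJ : 0 < J) {t : ℝ} (ht : 0 ≤ t) :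
    DifferentiableWithinAt ℝ (fun s => cov (u s)) (Set.Ici 0) t := by
  have h1 := (DifferentiableWithinAt.fun_sum fun j (_ : j ∈ Finset.univ) =>
    differentiableWithinAt_rankOne_self
      (hu.hasDerivWithinAt_sub_mean hJ ht j).differentiableWithinAt).const_smul (1 / (J : ℝ))
  exact h1

lemma covRate_le (hΓ : Γ.PosDef) (hlam : 0 < lam) {ρ : ℝ} (hρ : ρ ≤ 1) {g : ℝ}
    (hcoer : ∀ x : Vec d, g * ‖x‖ ^ 2 ≤ inner ℝ x (act C₀⁻¹ x)) (x : Fin J → Vec d) (v : Vec d) :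
    covRate G Γ C₀ lam ρ x v ≤ -(2 * lam * g) * ‖cov x v‖ ^ 2 := by
  have h1 := mul_nonneg (sub_nonneg.mpr hρ)
    (inner_act_nonneg hΓ.inv (crossCov (fun k => G (x k)) x v))
  have h2 := mul_le_mul_of_nonneg_left (hcoer (cov x v)) hlam.le
  rw [covRate]
  linarith

lemma le_covRate (hlam : 0 < lam) {ρ κ : ℝ} (hρ : ρ ≤ 1) (x : Fin J → Vec d)
    (hκ : spread (fun k => G (x k)) ≤ κ * spread x) (v : Vec d) :
    -(2 * (1 - ρ) * (‖act Γ⁻¹‖ * κ) * spread x) * inner ℝ v (cov x v)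
      - 2 * lam * ‖act C₀⁻¹‖ * ‖cov x v‖ ^ 2 ≤ covRate G Γ C₀ lam ρ x v := by
  have h0 := sub_nonneg.mpr hρ
  have h1 : inner ℝ (crossCov (fun k => G (x k)) x v)
      (act Γ⁻¹ (crossCov (fun k => G (x k)) x v)) ≤
      ‖act Γ⁻¹‖ * (κ * spread x * inner ℝ v (cov x v)) := by
    refine (inner_apply_le_opNorm _ _).trans ?_
    gcongr
    refine (norm_sq_crossCov_le x (fun k => G (x k)) v).trans ?_
    exact mul_le_mul_of_nonneg_right hκ (inner_cov_nonneg x v)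
  have h2 := mul_le_mul_of_nonneg_left h1 h0
  have h3 := mul_le_mul_of_nonneg_left (inner_apply_le_opNorm (act C₀⁻¹) (cov x v)) hlam.le
  rw [covRate]
  linarith

lemma IsFlowSolution.exists_spread_le
    (hu : IsFlowSolution G y Γ C₀ lam h τ ρ (fun _ => 0) u) (hJ : 0 < J)
    (hΓ : Γ.PosDef) (hC₀ : C₀.PosDef) (hlam : 0 < lam) (hρ : ∀ t, 0 ≤ t → ρ t ≤ 1) :
    ∃ q : ℝ, 0 ≤ q ∧ ∀ t, 0 ≤ t → spread (u t) ≤ q / (t + 1) := by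
  obtain ⟨g, hg, hcoer⟩ := exists_coercive_act_inv hC₀
  set a := 2 * lam * g
  have ha : 0 < a := by positivity
  let e := EuclideanSpace.basisFun (Fin d) ℝ
  let M : Fin d → ℝ := fun i => max (inner ℝ (e i) (cov (u 0) (e i))) (1 / a)
  refine ⟨∑ i, M i, Finset.sum_nonneg fun i _ => le_max_of_le_right (by positivity),
    fun t ht => ?_⟩
  rw [spread_eq_sum, Finset.sum_div]
  refine Finset.sum_le_sum fun i _ => ?_
  refine le_div_of_deriv_le_neg_sq (φ := fun s => inner ℝ (e i) (cov (u s) (e i))) ha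
    (le_max_left _ _) (le_max_right _ _) (fun s _ => inner_cov_nonneg _ _)
    (fun s hs => hu.hasDerivWithinAt_inner_cov hJ hs (e i)) (fun s hs => ?_) ht
  refine (covRate_le hΓ hlam (hρ s hs) hcoer _ _).trans ?_
  have h1 : inner ℝ (e i) (cov (u s) (e i)) ≤ ‖cov (u s) (e i)‖ := by
    simpa [e.norm_eq_one] using real_inner_le_norm (e i) (cov (u s) (e i))
  have h2 := pow_le_pow_left₀ (inner_cov_nonneg (u s) (e i)) h1 2
  have h3 := mul_le_mul_of_nonneg_left h2 ha.le
  simp only [a] at h3 ⊢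
  linarith

lemma IsFlowSolution.inner_cov_pos
    (hu : IsFlowSolution G y Γ C₀ lam h τ ρ (fun _ => 0) u) (hJ : 0 < J)
    (hlam : 0 < lam) (hρ : ∀ t, 0 ≤ t → ρ t ∈ Set.Icc (0 : ℝ) 1)
    {q κ : ℝ} (hq : ∀ t, 0 ≤ t → spread (u t) ≤ q) (hκ : 0 ≤ κ)
    (hspread : ∀ t, 0 ≤ t → spread (fun k => G (u t k)) ≤ κ * spread (u t))
    {v : Vec d} (hv : 0 < inner ℝ v (cov (u 0) v)) {t : ℝ} (ht : 0 ≤ t) :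
    0 < inner ℝ v (cov (u t) v) := by
  have h1 := exp_mul_le_of_le_deriv (M := 2 * (‖act Γ⁻¹‖ * κ) * q + 2 * lam * ‖act C₀⁻¹‖ * q)
    (φ := fun s => inner ℝ v (cov (u s) v))
    (fun s hs => hu.hasDerivWithinAt_inner_cov hJ hs v) (fun s hs => ?_) ht
  · exact pos_of_mul_pos_left (hv.trans_le h1) (Real.exp_pos _).le
  · refine le_trans ?_ (le_covRate hlam (hρ s hs).2 (u s) (hspread s hs) v)
    have hφ := inner_cov_nonneg (u s) v
    have h2 : 2 * (1 - ρ s) * (‖act Γ⁻¹‖ * κ) * spread (u s) ≤ 2 * 1 * (‖act Γ⁻¹‖ * κ) * q := by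
      have := (hρ s hs).1
      have h3 := (hρ s hs).2
      have h4 := spread_nonneg (u s)
      gcongr
      · linarith
      · exact hq s hs
    have h3 : 2 * lam * ‖act C₀⁻¹‖ * ‖cov (u s) v‖ ^ 2 ≤
        2 * lam * ‖act C₀⁻¹‖ * (q * inner ℝ v (cov (u s) v)) := by
      gcongr
      exact (norm_sq_cov_le _ _).trans (mul_le_mul_of_nonneg_right (hq s hs) hφ)
    have h4 := mul_le_mul_of_nonneg_right h2 hφ
    linarith

/-- The empirical covariance decays no faster than `1 / (S t)` for every `S > 2 λ ‖C₀⁻¹‖`. -/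
lemma IsFlowSolution.exists_le_inner_cov
    (hu : IsFlowSolution G y Γ C₀ lam h τ ρ (fun _ => 0) u) (hJ : 0 < J)
    (hlam : 0 < lam) (hρ : ∀ t, 0 ≤ t → ρ t ∈ Set.Icc (0 : ℝ) 1)
    (hρlim : Tendsto ρ atTop (𝓝 1))
    {q κ : ℝ} (hq0 : 0 ≤ q) (hq : ∀ t, 0 ≤ t → spread (u t) ≤ q / (t + 1)) (hκ : 0 ≤ κ)
    (hspread : ∀ t, 0 ≤ t → spread (fun k => G (u t k)) ≤ κ * spread (u t))
    (hcov : ∀ z : Vec d, z ≠ 0 → 0 < inner ℝ z (cov (u 0) z))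
    {S : ℝ} (hS : 2 * lam * ‖act C₀⁻¹‖ < S) :
    ∃ T : ℝ, 0 ≤ T ∧ ∀ t, T ≤ t → ∀ v : Vec d, ‖v‖ ^ 2 ≤ S * (t + 1) * inner ℝ v (cov (u t) v) := by
  set s := 2 * lam * ‖act C₀⁻¹‖
  have hs : 0 ≤ s := by positivity
  have hSpos : 0 < S := hs.trans_lt hS
  have hq' : ∀ t, 0 ≤ t → spread (u t) ≤ q := fun t ht =>
    (hq t ht).trans (div_le_self hq0 (by linarith))
  have hpos : ∀ t, 0 ≤ t → ∀ z : Vec d, z ≠ 0 → 0 < inner ℝ z (cov (u t) z) := fun t ht z hz =>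
    hu.inner_cov_pos hJ hlam hρ hq' hκ hspread (hcov z hz) ht
  have hunit : ∀ t, 0 ≤ t → IsUnit (cov (u t)) := by
    intro t ht
    rw [ContinuousLinearMap.isUnit_iff_isUnit_toLinearMap, LinearMap.isUnit_iff_ker_eq_bot,
      LinearMap.ker_eq_bot']
    intro z hz
    by_contra hne
    have h1 := hpos t ht z hne
    have h2 : cov (u t) z = 0 := hz
    rw [h2, inner_zero_right] at h1
    exact h1.false
  have hinv : ∀ t, 0 ≤ t → ∀ v, cov (u t) (Ring.inverse (cov (u t)) v) = v := fun t ht v =>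
    congrArg (fun T : Vec d →L[ℝ] Vec d => T v) (Ring.mul_inverse_cancel _ (hunit t ht))
  set ε := (S - s) / (2 * S)
  have hε : 0 < ε := div_pos (by linarith) (by positivity)
  have hε1 : ε < 1 := by rw [div_lt_one (by positivity)]; linarith
  set c := 2 * (‖act Γ⁻¹‖ * κ) * q
  have hlim : Tendsto (fun t => (1 - ρ t) * c) atTop (𝓝 0) := by
    simpa using ((tendsto_const_nhds (x := (1 : ℝ))).sub hρlim).mul_const c
  obtain ⟨T₀, hT₀⟩ := eventually_atTop.mp (hlim.eventually_le_const hε)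
  set T := max T₀ 0
  have hT : 0 ≤ T := le_max_right _ _
  set B := ‖Ring.inverse (cov (u T))‖
  have hψ : ∀ t, T ≤ t → ∀ v, inner ℝ v (Ring.inverse (cov (u t)) v) ≤
      s * ‖v‖ ^ 2 / (1 - ε) * (t + 1) + B * ‖v‖ ^ 2 * (t + 1) ^ ε := by
    intro t ht v
    have hψform : ∀ a, 0 ≤ a → inner ℝ v (Ring.inverse (cov (u a)) v) =
        inner ℝ (Ring.inverse (cov (u a)) v) (cov (u a) (Ring.inverse (cov (u a)) v)) :=
      fun a ha => by rw [hinv a ha, real_inner_comm]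
    have hψ0 : ∀ a, 0 ≤ a → 0 ≤ inner ℝ v (Ring.inverse (cov (u a)) v) := fun a ha => by
      rw [hψform a ha]; exact inner_cov_nonneg _ _
    have h1 := le_of_deriv_le_add_div (s := s * ‖v‖ ^ 2)
      (ψ := fun a => inner ℝ v (Ring.inverse (cov (u a)) v)) (by positivity) hε.le hε1 hT
      (hψ0 T hT)
      (fun a ha => (hasDerivWithinAt_inner_inverse (uniqueDiffOn_Ici 0 a (hT.trans ha))
        (hu.differentiableWithinAt_cov hJ (hT.trans ha)) (hunit a (hT.trans ha))
        (inner_cov_comm (u a)) (fun w => hu.hasDerivWithinAt_inner_cov hJ (hT.trans ha) w)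
        v).mono (Set.Ici_subset_Ici.mpr hT)) (fun a ha => ?_) ht
    · refine h1.trans ?_
      have ht1 : 0 ≤ t + 1 := by linarith
      have h2 := inner_apply_le_opNorm (Ring.inverse (cov (u T))) v
      gcongr
    · have ha0 := hT.trans ha
      have h2 := le_covRate (Γ := Γ) (C₀ := C₀) hlam (hρ a ha0).2 (u a) (hspread a ha0)
        (Ring.inverse (cov (u a)) v)
      rw [← hψform a ha0, hinv a ha0] at h2
      have ha1 : 0 < a + 1 := by linarith
      have h3 : 2 * (1 - ρ a) * (‖act Γ⁻¹‖ * κ) * spread (u a) ≤ ε / (a + 1) := by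
        have h4 := hT₀ a ((le_max_left _ _).trans ha)
        have h5 := sub_nonneg.mpr (hρ a ha0).2
        calc _ ≤ 2 * (1 - ρ a) * (‖act Γ⁻¹‖ * κ) * (q / (a + 1)) := by
              gcongr; exact hq a ha0
          _ = (1 - ρ a) * c / (a + 1) := by simp only [c]; ring
          _ ≤ _ := by gcongr
      have h4 := mul_le_mul_of_nonneg_right h3 (hψ0 a ha0)
      rw [div_mul_eq_mul_div] at h4
      simp only [s]
      linarith
  have hδ : 0 < S - s / (1 - ε) := by
    have h1 : 1 - ε = (S + s) / (2 * S) := by simp only [ε]; field_simp; ring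
    rw [sub_pos, h1, div_lt_iff₀ (by positivity)]
    field_simp
    linarith
  have hlim2 : Tendsto (fun t : ℝ => B * (t + 1) ^ (-(1 - ε))) atTop (𝓝 0) := by
    have h1 := (tendsto_rpow_neg_atTop (sub_pos.mpr hε1)).comp
      (tendsto_atTop_add_const_right atTop (1 : ℝ) tendsto_id)
    simpa using h1.const_mul B
  obtain ⟨T₁, hT₁⟩ := eventually_atTop.mp (hlim2.eventually_le_const hδ)
  refine ⟨max T T₁, hT.trans (le_max_left _ _), fun t ht v => ?_⟩
  have htT : T ≤ t := (le_max_left _ _).trans ht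
  have ht0 : 0 ≤ t := hT.trans htT
  have ht1 : 0 < t + 1 := by linarith
  have h1 : B * (t + 1) ^ ε ≤ (S - s / (1 - ε)) * (t + 1) := by
    have h2 := mul_le_mul_of_nonneg_right (hT₁ t ((le_max_right _ _).trans ht)) ht1.le
    have h3 : (t + 1) ^ (-(1 - ε)) * (t + 1) = (t + 1) ^ ε := by
      rw [← Real.rpow_add_one ht1.ne']; congr 1; ring
    rwa [mul_assoc, h3] at h2
  have h2 : inner ℝ v (Ring.inverse (cov (u t)) v) ≤ S * (t + 1) * ‖v‖ ^ 2 := by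
    have h3 := mul_le_mul_of_nonneg_right h1 (sq_nonneg ‖v‖)
    have h4 := hψ t htT v
    have h5 : s * ‖v‖ ^ 2 / (1 - ε) * (t + 1) = s / (1 - ε) * (t + 1) * ‖v‖ ^ 2 := by ring
    rw [h5] at h4
    linarith
  rcases eq_or_ne v 0 with rfl | hv
  · simp
  have h3 := sq_inner_apply_le (inner_cov_comm (u t)) (inner_cov_nonneg (u t)) v
    (Ring.inverse (cov (u t)) v)
  rw [hinv t ht0, real_inner_self_eq_norm_sq, real_inner_comm v] at h3
  have hv2 : 0 < ‖v‖ ^ 2 := by positivity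
  have h4 := mul_le_mul_of_nonneg_left h2 (inner_cov_nonneg (u t) v)
  have h5 : ‖v‖ ^ 2 * ‖v‖ ^ 2 ≤ S * (t + 1) * inner ℝ v (cov (u t) v) * ‖v‖ ^ 2 := by
    nlinarith
  exact le_of_mul_le_mul_right h5 hv2

end Flow

end EKI

namespace EKI

section Convergence

variable {d K m J : ℕ} {G : Vec d → Vec K} {y : Vec K} {Γ : Matrix (Fin K) (Fin K) ℝ}
  {C₀ : Matrix (Fin d) (Fin d) ℝ} {lam : ℝ} {h : Fin m → Vec d → ℝ} {τ : ℝ} {ρ : ℝ → ℝ}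
  {u : ℝ → Fin J → Vec d}

lemma IsFlowSolution.strictlyFeasible
    (hu : IsFlowSolution G y Γ C₀ lam h τ ρ (fun _ => 0) u) (hJ : 0 < J)
    (hh : ∀ i, Continuous (h i)) (hmean : StrictlyFeasible h (mean (u 0))) {t : ℝ} (ht : 0 ≤ t) :
    StrictlyFeasible h (mean (u t)) := by
  intro i
  by_contra hneg
  push Not at hneg
  have hcont : ContinuousOn (fun s => h i (mean (u s))) (Set.Icc 0 t) := fun s hs =>
    (hh i).continuousAt.comp_continuousWithinAt
      ((hu.hasDerivWithinAt_mean hJ hs.1).continuousWithinAt.mono Set.Icc_subset_Ici_self)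
  obtain ⟨s, hs, hs0⟩ := intermediate_value_Icc ht hcont ⟨(hmean i).le, hneg⟩
  exact hu.ne_zero s hs.1 i hs0

lemma IsFlowSolution.hasDerivWithinAt_barrierPotential
    (hu : IsFlowSolution G y Γ C₀ lam h τ ρ (fun _ => 0) u) (hJ : 0 < J) {Φ : Vec d → ℝ}
    (hΦ : Differentiable ℝ Φ) (hh : ∀ i, Differentiable ℝ (h i))
    {t : ℝ} (ht : 0 ≤ t) (hfeas : StrictlyFeasible h (mean (u t))) :
    HasDerivWithinAt (fun s => barrierPotential Φ h τ (mean (u s)))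
      (inner ℝ (barrierGrad Φ h τ (mean (u t)))
        (mean (inflatedDrift G y Γ C₀ lam (ρ t) 0 (u t)) + barrierForce h τ (u t)))
      (Set.Ici 0) t := by
  have h1 := hasGradientAt_iff_hasFDerivAt.mp
    (hasGradientAt_barrierPotential (τ := τ) hΦ hh hfeas)
  exact h1.comp_hasDerivWithinAt t (hu.hasDerivWithinAt_mean hJ ht)

/-- Dissipation of the barrier potential up to the linearisation error. -/
lemma exists_inner_barrierGrad_le (hJ : 0 < J) (hG : Differentiable ℝ G)
    (hΓ : Γ.PosDef) (hC₀ : C₀.PosDef) {b : ℝ} (hb : 0 ≤ b)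
    (hres : ∀ x₁ x₂ : Vec d, ‖G x₁ - G x₂ - fderiv ℝ G x₂ (x₁ - x₂)‖ ≤ b * ‖x₁ - x₂‖ ^ 2)
    {M : ℝ} (hM : 0 ≤ M)
    (hgrowth : ∀ x, ‖G x - y‖ ≤ M * (1 + ‖x‖) ∧ ‖fderiv ℝ G x‖ ≤ M * (1 + ‖x‖))
    {q : ℝ} (hq0 : 0 ≤ q) (hq : ∀ t, 0 ≤ t → spread (u t) ≤ q / (t + 1)) :
    ∃ A : ℝ, 0 ≤ A ∧ ∀ t, 0 ≤ t → ∀ η : ℝ, 0 < η →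
      inner ℝ (barrierGrad (regPotential G y Γ C₀ lam) h τ (mean (u t)))
        (mean (inflatedDrift G y Γ C₀ lam (ρ t) 0 (u t)) + barrierForce h τ (u t)) ≤
      -(1 - η) * inner ℝ (barrierGrad (regPotential G y Γ C₀ lam) h τ (mean (u t)))
        (cov (u t) (barrierGrad (regPotential G y Γ C₀ lam) h τ (mean (u t))))
      + A * (1 + ‖mean (u t)‖) ^ 2 / η / (t + 1) ^ 2 := by
  set a := ‖act Γ⁻¹‖ * b * (M * (1 + J * q) + J * (M + b * q))
  have ha : 0 ≤ a := by positivity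
  refine ⟨(a * q) ^ 2 / 4, by positivity, fun t ht η hη => ?_⟩
  rw [inner_barrierGrad_mean_drift hJ hG y hΓ hC₀]
  have hs : ∀ j, |linearisationError G y Γ (u t) j| ≤
      a * (q / (t + 1)) * (1 + ‖mean (u t)‖) := fun j => by
    refine (abs_linearisationError_le hJ y Γ hb hres hM hgrowth
      ((hq t ht).trans (div_le_self hq0 (by linarith))) j).trans ?_
    gcongr
    exact hq t ht
  have h1 := mean_inner_mul_le hJ (u t)
    (barrierGrad (regPotential G y Γ C₀ lam) h τ (mean (u t))) _ hη hs
  have h2 : (a * (q / (t + 1)) * (1 + ‖mean (u t)‖)) ^ 2 / (4 * η) =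
      (a * q) ^ 2 / 4 * (1 + ‖mean (u t)‖) ^ 2 / η / (t + 1) ^ 2 := by
    have : t + 1 ≠ 0 := by positivity
    field_simp
  rw [h2] at h1
  linarith

lemma one_add_norm_sq_le {E : Type*} [SeminormedAddCommGroup E] {μ f : ℝ} (hμ : 0 < μ)
    {x v : E} (hf : μ / 2 * ‖x - v‖ ^ 2 ≤ f) :
    (1 + ‖x‖) ^ 2 ≤ (2 * (1 + ‖v‖) ^ 2 + 4 / μ) * (1 + f) := by
  have h1 : ‖x‖ ≤ ‖x - v‖ + ‖v‖ := by simpa using norm_add_le (x - v) v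
  have hf0 : 0 ≤ f := le_trans (by positivity) hf
  have h2 : ‖x - v‖ ^ 2 ≤ 2 / μ * f := by
    rw [div_mul_eq_mul_div, le_div_iff₀ hμ]; linarith
  have h3 : (1 + ‖x‖) ^ 2 ≤ ((1 + ‖v‖) + ‖x - v‖) ^ 2 := by
    exact pow_le_pow_left₀ (by positivity) (by linarith) 2
  have h4 : ((1 + ‖v‖) + ‖x - v‖) ^ 2 ≤ 2 * (1 + ‖v‖) ^ 2 + 2 * ‖x - v‖ ^ 2 := by
    nlinarith [sq_nonneg (1 + ‖v‖ - ‖x - v‖)]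
  have h5 : 0 ≤ 2 * (1 + ‖v‖) ^ 2 * f + 4 / μ := by positivity
  have h6 : 2 * (2 / μ * f) = 4 / μ * f := by ring
  linarith

/-- The barrier potential stays bounded along the flow, hence so does the mean. -/
lemma IsFlowSolution.exists_mean_bound
    (hu : IsFlowSolution G y Γ C₀ lam h τ ρ (fun _ => 0) u) (hJ : 0 < J) {μ : ℝ} (hμ : 0 < μ)
    (hΦ : Differentiable ℝ (regPotential G y Γ C₀ lam)) (hh : ∀ i, Differentiable ℝ (h i))
    (hfeas : ∀ t, 0 ≤ t → StrictlyFeasible h (mean (u t))) {v : Vec d}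
    (hgap : ∀ w, StrictlyFeasible h w → μ / 2 * ‖w - v‖ ^ 2 ≤
      barrierPotential (regPotential G y Γ C₀ lam) h τ w
        - barrierPotential (regPotential G y Γ C₀ lam) h τ v)
    {A : ℝ} (hA : 0 ≤ A)
    (hdiss : ∀ t, 0 ≤ t → ∀ η : ℝ, 0 < η →
      inner ℝ (barrierGrad (regPotential G y Γ C₀ lam) h τ (mean (u t)))
        (mean (inflatedDrift G y Γ C₀ lam (ρ t) 0 (u t)) + barrierForce h τ (u t)) ≤
      -(1 - η) * inner ℝ (barrierGrad (regPotential G y Γ C₀ lam) h τ (mean (u t)))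
        (cov (u t) (barrierGrad (regPotential G y Γ C₀ lam) h τ (mean (u t))))
      + A * (1 + ‖mean (u t)‖) ^ 2 / η / (t + 1) ^ 2) :
    ∃ R : ℝ, 0 ≤ R ∧ ∀ t, 0 ≤ t → (1 + ‖mean (u t)‖) ^ 2 ≤ R := by
  set f : ℝ → ℝ := fun t => barrierPotential (regPotential G y Γ C₀ lam) h τ (mean (u t))
    - barrierPotential (regPotential G y Γ C₀ lam) h τ v with hf
  have hf0 : ∀ t, 0 ≤ t → 0 ≤ f t := fun t ht =>
    le_trans (by positivity) (hgap _ (hfeas t ht))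
  set B := 2 * (1 + ‖v‖) ^ 2 + 4 / μ
  have hB : 0 ≤ B := by positivity
  have hsq : ∀ t, 0 ≤ t → (1 + ‖mean (u t)‖) ^ 2 ≤ B * (1 + f t) := fun t ht =>
    one_add_norm_sq_le hμ (hgap _ (hfeas t ht))
  have h0 := hf0 0 le_rfl
  refine ⟨B * ((1 + f 0) * Real.exp (A * B)), by positivity, fun t ht => (hsq t ht).trans ?_⟩
  refine mul_le_mul_of_nonneg_left ?_ hB
  refine one_add_le_of_deriv_le (by positivity) (by positivity)
    (fun s hs => (hu.hasDerivWithinAt_barrierPotential hJ hΦ hh hs (hfeas s hs)).sub_const _)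
    (fun s hs => ?_) ht
  have h1 := hdiss s hs 1 one_pos
  rw [sub_self, neg_zero, zero_mul, zero_add, div_one] at h1
  refine h1.trans ?_
  rw [div_mul_eq_mul_div, mul_assoc A B]
  gcongr
  exact hsq s hs

/-- Algebraic decay of a Lyapunov function dissipated through a covariance of order `1 / t`. -/
lemma exists_rate {f f' n2 D : ℝ → ℝ} {μ γ s S A T : ℝ} (hμ : 0 < μ) (hγ : 1 < γ)
    (hs : 0 ≤ s) (hsγ : s < μ * γ) (hS : S = s + μ * γ) (hA : 0 ≤ A) (hT : 0 ≤ T)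
    (hder : ∀ t, T ≤ t → HasDerivWithinAt f (f' t) (Set.Ici T) t)
    (hdiss : ∀ t, T ≤ t → ∀ η : ℝ, 0 < η → f' t ≤ -(1 - η) * D t + A / η / (t + 1) ^ 2)
    (hlow : ∀ t, T ≤ t → n2 t ≤ S * (t + 1) * D t)
    (hPL : ∀ t, T ≤ t → 2 * μ * f t ≤ n2 t) :
    ∃ c₁ c₂ tbar : ℝ, 0 < c₁ ∧ 0 < c₂ ∧ 0 ≤ tbar ∧ ∀ t : ℝ, tbar ≤ t →
      f t ≤ (c₁ / (t + c₂)) ^ (1 / γ) := by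
  have hγ0 : 0 < γ := by linarith
  have hμγ : 0 < μ * γ := by positivity
  have hS0 : 0 < S := by linarith
  set η := 1 - S / (2 * (μ * γ)) with hη
  have hη0 : 0 < η := by
    rw [hη, sub_pos, div_lt_one (by positivity)]; linarith
  obtain ⟨c, hc, hle⟩ := exists_le_rpow_of_deriv_le (α := 1 / γ) (M := A / η)
    (by rw [div_lt_one hγ0]; exact hγ) (by positivity) hT hder (fun t ht => by
      have ht1 : 0 < t + 1 := by linarith
      refine (hdiss t ht η hη0).trans ?_
      gcongr
      have h1 : 2 * μ * f t ≤ S * (t + 1) * D t := (hPL t ht).trans (hlow t ht)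
      have h2 : -(1 - η) = -(S / (2 * (μ * γ))) := by rw [hη]; ring
      rw [h2]
      have h3 : -(1 / γ) * f t / (t + 1) = -(2 * μ * f t) / (2 * (μ * γ) * (t + 1)) := by
        field_simp
      have h4 : -(S / (2 * (μ * γ))) * D t =
          -(S * (t + 1) * D t) / (2 * (μ * γ) * (t + 1)) := by
        field_simp
      rw [h3, h4]
      gcongr)
  refine ⟨c ^ γ, 1, T, by positivity, one_pos, hT, fun t ht => (hle t ht).trans_eq ?_⟩
  have ht1 : 0 < t + 1 := by linarith
  rw [Real.div_rpow (by positivity) ht1.le, ← Real.rpow_mul hc.le, mul_one_div_cancel hγ0.ne',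
    Real.rpow_one, Real.rpow_neg ht1.le, ← div_eq_mul_inv]

lemma tendsto_zero_of_rate {f : ℝ → ℝ} (hf : ∀ t, 0 ≤ t → 0 ≤ f t) {γ c₁ c₂ tbar : ℝ}
    (hγ : 0 < γ)
    (hle : ∀ t, tbar ≤ t → f t ≤ (c₁ / (t + c₂)) ^ (1 / γ)) : Tendsto f atTop (𝓝 0) := by
  have h1 : Tendsto (fun t : ℝ => c₁ / (t + c₂)) atTop (𝓝 0) :=
    (tendsto_atTop_add_const_right atTop c₂ tendsto_id).const_div_atTop c₁
  have h2 := h1.rpow_const (p := 1 / γ) (Or.inr (by positivity))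
  rw [Real.zero_rpow (by positivity)] at h2
  refine tendsto_of_tendsto_of_tendsto_of_le_of_le' tendsto_const_nhds h2 ?_ ?_
  · filter_upwards [eventually_ge_atTop 0] with t ht using hf t ht
  · filter_upwards [eventually_ge_atTop tbar] with t ht using hle t ht

end Convergence

end EKI
theorem mainTheorem1 {d K m J : ℕ}
    (G : EKI.Vec d → EKI.Vec K) (y : EKI.Vec K)
    (Γ : Matrix (Fin K) (Fin K) ℝ) (hΓ : Γ.PosDef)
    (C₀ : Matrix (Fin d) (Fin d) ℝ) (hC₀ : C₀.PosDef)
    (lam : ℝ) (hlam : 0 < lam)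
    -- the regularised potential is C², μ-strongly convex and L-smooth
    (hΦ : ContDiff ℝ 2 (EKI.regPotential G y Γ C₀ lam))
    (μ : ℝ) (hμ : 0 < μ)
    (hconv : ∀ x₁ x₂ : EKI.Vec d,
      inner ℝ (gradient (EKI.regPotential G y Γ C₀ lam) x₂) (x₁ - x₂) + μ / 2 * ‖x₁ - x₂‖ ^ 2
        ≤ EKI.regPotential G y Γ C₀ lam x₁ - EKI.regPotential G y Γ C₀ lam x₂)
    (L : ℝ) (hL : 0 < L)
    (hsmooth : ∀ x₁ x₂ : EKI.Vec d,
      ‖gradient (EKI.regPotential G y Γ C₀ lam) x₁ - gradient (EKI.regPotential G y Γ C₀ lam) x₂‖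
        ≤ L * ‖x₁ - x₂‖)
    -- the forward map is locally Lipschitz with a quadratic linearisation error
    (hGlip : LocallyLipschitz G) (hGdiff : Differentiable ℝ G)
    (bres : ℝ)
    (hres : ∀ x₁ x₂ : EKI.Vec d,
      ‖G x₁ - G x₂ - fderiv ℝ G x₂ (x₁ - x₂)‖ ≤ bres * ‖x₁ - x₂‖ ^ 2)
    -- convex C¹ constraints with a strictly feasible point
    (h : Fin m → EKI.Vec d → ℝ)
    (hhconv : ∀ i, ConvexOn ℝ Set.univ (h i)) (hhdiff : ∀ i, ContDiff ℝ 1 (h i))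
    (hslater : ∃ v, EKI.StrictlyFeasible h v)
    (τ : ℝ) (hτ : 0 < τ)
    -- inflation factor of the data misfit; the regularisation term is not inflated
    (ρ : ℝ → ℝ) (hρ : ∀ t, 0 ≤ t → ρ t ∈ Set.Icc (0 : ℝ) 1) (hρlim : Tendsto ρ atTop (𝓝 1))
    -- a solution of the flow whose initial mean is strictly feasible and whose initial
    -- empirical covariance is nondegenerate
    (hJ : d < J)
    (u : ℝ → Fin J → EKI.Vec d)
    (hu : EKI.IsFlowSolution G y Γ C₀ lam h τ ρ (fun _ => 0) u)
    (hmean : EKI.StrictlyFeasible h (EKI.mean (u 0)))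
    (hcov : ∀ z : EKI.Vec d, z ≠ 0 → 0 < inner ℝ z (EKI.cov (u 0) z))
    (ustar : EKI.Vec d)
    (hustar : EKI.IsBarrierMinimiser (EKI.regPotential G y Γ C₀ lam) h τ ustar) :
    (∀ t, 0 ≤ t → EKI.StrictlyFeasible h (EKI.mean (u t))) ∧
    (∀ γ : ℝ, max 1 (lam * ‖EKI.act C₀⁻¹‖ / μ) < γ →
      ∃ c₁ c₂ tbar : ℝ, 0 < c₁ ∧ 0 < c₂ ∧ 0 ≤ tbar ∧ ∀ t : ℝ, tbar ≤ t →
        EKI.barrierPotential (EKI.regPotential G y Γ C₀ lam) h τ (EKI.mean (u t))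
          - EKI.barrierPotential (EKI.regPotential G y Γ C₀ lam) h τ ustar
          ≤ (c₁ / (t + c₂)) ^ (1 / γ)) ∧
    Tendsto (fun t =>
        EKI.barrierPotential (EKI.regPotential G y Γ C₀ lam) h τ (EKI.mean (u t))
          - EKI.barrierPotential (EKI.regPotential G y Γ C₀ lam) h τ ustar)
      atTop (𝓝 0) := by

  have hJ0 : 0 < J := by omega
  have hd : Differentiable ℝ (EKI.regPotential G y Γ C₀ lam) := hΦ.differentiable (by norm_num)
  have hh : ∀ i, Differentiable ℝ (h i) := fun i => (hhdiff i).differentiable (by norm_num)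
  have hfeas : ∀ t, 0 ≤ t → EKI.StrictlyFeasible h (EKI.mean (u t)) := fun t ht =>
    hu.strictlyFeasible hJ0 (fun i => (hh i).continuous) hmean ht
  have hres' : ∀ x₁ x₂ : EKI.Vec d,
      ‖G x₁ - G x₂ - fderiv ℝ G x₂ (x₁ - x₂)‖ ≤ |bres| * ‖x₁ - x₂‖ ^ 2 := fun x₁ x₂ =>
    (hres x₁ x₂).trans (by gcongr; exact le_abs_self bres)
  have hgap := fun w => EKI.norm_sq_sub_minimiser_le hτ hd hconv hhconv hh hustar (w := w)
  obtain ⟨M, hM, hgrowth⟩ := EKI.exists_linear_growth hΓ hC₀ hlam hμ hconv hL hsmooth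
    (abs_nonneg bres) hres'
  obtain ⟨q, hq0, hq⟩ := hu.exists_spread_le hJ0 hΓ hC₀ hlam (fun t ht => (hρ t ht).2)
  obtain ⟨A, hA, hdiss⟩ := EKI.exists_inner_barrierGrad_le (lam := lam) (h := h) (τ := τ) (ρ := ρ)
    hJ0 hGdiff hΓ hC₀ (abs_nonneg bres) hres' hM hgrowth hq0 hq
  obtain ⟨R, hR, hbound⟩ := hu.exists_mean_bound hJ0 hμ hd hh hfeas hgap hA hdiss
  have hfderiv : ∀ t, 0 ≤ t → ‖fderiv ℝ G (EKI.mean (u t))‖ ≤ M * R := fun t ht => by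
    refine (hgrowth _).2.trans (mul_le_mul_of_nonneg_left ?_ hM)
    nlinarith [hbound t ht, norm_nonneg (EKI.mean (u t))]
  have hspread := fun t (ht : 0 ≤ t) => EKI.spread_map_le hJ0 (abs_nonneg bres) hres' (hfderiv t ht)
    ((hq t ht).trans (div_le_self hq0 (by linarith)))
  have hrate : ∀ γ : ℝ, max 1 (lam * ‖EKI.act C₀⁻¹‖ / μ) < γ →
      ∃ c₁ c₂ tbar : ℝ, 0 < c₁ ∧ 0 < c₂ ∧ 0 ≤ tbar ∧ ∀ t : ℝ, tbar ≤ t →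
        EKI.barrierPotential (EKI.regPotential G y Γ C₀ lam) h τ (EKI.mean (u t))
          - EKI.barrierPotential (EKI.regPotential G y Γ C₀ lam) h τ ustar
          ≤ (c₁ / (t + c₂)) ^ (1 / γ) := by
    intro γ hγ
    obtain ⟨hγ1, hγ2⟩ := max_lt_iff.mp hγ
    rw [div_lt_iff₀ hμ, mul_comm γ] at hγ2
    obtain ⟨T, hT, hlow⟩ := hu.exists_le_inner_cov hJ0 hlam hρ hρlim hq0 hq (sq_nonneg _) hspread
      hcov (S := lam * ‖EKI.act C₀⁻¹‖ + μ * γ) (by linarith)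
    refine EKI.exists_rate hμ hγ1 (by positivity) hγ2 rfl (mul_nonneg hA hR) hT
      (fun t ht => ((hu.hasDerivWithinAt_barrierPotential hJ0 hd hh (hT.trans ht)
        (hfeas t (hT.trans ht))).sub_const _).mono (Set.Ici_subset_Ici.mpr hT))
      (fun t ht η hη => (hdiss t (hT.trans ht) η hη).trans ?_)
      (fun t ht => hlow t ht _)
      (fun t ht => EKI.barrierPotential_PL hτ hμ hconv hhconv hh (hfeas t (hT.trans ht)) hustar.1)
    gcongr
    exact hbound t (hT.trans ht)
  refine ⟨hfeas, hrate, ?_⟩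
  obtain ⟨c₁, c₂, tbar, -, -, -, hle⟩ := hrate _ (lt_add_one _)
  refine EKI.tendsto_zero_of_rate
    (fun t ht => sub_nonneg.mpr (hustar.2 _ (hfeas t ht))) ?_ hle
  have := le_max_left 1 (lam * ‖EKI.act C₀⁻¹‖ / μ)
  linarith
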